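/- Let $m\ge 1$, let $(a_1,b_1),\dots,(a_m,b_m)\in(0,\infty)^2$, and let $w_1,\dots,w_m>0$ with $\sum_i w_i=1$. Let $i_2,i_3,\dots$ be i.i.d. random indices in $\{1,\dots,m\}$ with law $(w_i)_{i=1}^m$, and let $$x_0=x_1=1,\qquad x_{n+1}=a_{i_{n+1}}x_n+b_{i_{n+1}}x_{n-1}\quad(n\ge 1).$$ Put $M_i=\begin{pmatrix}0&1\\ b_i&a_i\end{pmatrix}$. Then all entries of the matrices $A_{ij}=M_iM_j$ $(1\le i,j\le m)$ are positive, and almost surely $$\lim_{n\to\infty}\sqrt[n]{x_n}=\exp\Bigl(\tfrac12\sum_{k=0}^\infty\bigl(T^k\boldsymbol v\bigr)_0\Bigr),$$ where the series of the terms $(T^k\boldsymbol v)_0$ converges to a real number and $T$, $\boldsymbol v$ are as follows. For $A=\begin{pmatrix}p&q\\ r&s\end{pmatrix}$ let $F(A)=\frac12\begin{pmatrix}p-q-r+s&p+q-r-s\\ p-q+r-s&p+q+r+s\end{pmatrix}$. Let $f_{ij}$ and $f_{ij}^{\top}$ be the Möbius maps of $F(A_{ij})$ and of its transpose $F(A_{ij})^{\top}$,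 where the Möbius map of $\begin{pmatrix}\alpha&\beta\\ \gamma&\delta\end{pmatrix}$ is $x\mapsto\frac{\alpha x+\beta}{\gamma x+\delta}$. For $x,c\in\mathbb C$ with $|x|\le 1$ let $v(x;c)$ be the bounded sequence with $v(x;c)_0=c$ and $v(x;c)_n=-(-x)^n/n$ for $n\ge1$, and let $V$ be the complex linear span of all these sequences. Then $$\boldsymbol v=\sum_{i,j}w_iw_j\,v\Bigl(f_{ij}(0);\ \tfrac12\log\frac{\det F(A_{ij})}{f_{ij}'(0)}\Bigr)$$ lies in $V$, and $T:V\to V$ is the linear operator $(Tu)_k=\sum_{n=0}^\infty \beta_{k,n}u_n$ (the series converges for all $u\in V$ and $k\ge0$, and $Tu\in V$), where $\beta_{k,0}=0$ for $k\ge0$, $\beta_{0,n}=\sum_{i,j}w_iw_j\,f_{ij}^{\top}(0)^n$ for $n\ge1$, and for $k,n\ge1$ $$\beta_{k,n}=\sum_{i,j}w_iw_j\sum_{\ell=1}^{\min\{k,n\}}\binom n\ell\binom{k-1}{\ell-1}f_{ij}^{\top}(0)^{\,n-\ell}\,\bigl(-f_{ij}(0)\bigr)^{k-\ell}\,f_{ij}'(0)^{\ell},$$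 with the convention $0^0=1$. -/

import Mathlib

open Filter Topology MeasureTheory ProbabilityTheory Matrix

noncomputable section

namespace ThreeTerm

/-- The sequence `v(x ; c)`, with entry `c` at `0` and `-(-x)^n / n` at `n ≥ 1`. -/
def vSeq (x c : ℂ) (n : ℕ) : ℂ :=
  if n = 0 then c else -((-x) ^ n / (n : ℂ))

/-- The linear span `V` of the sequences `v(x ; c)` with `|x| ≤ 1`, inside all complex sequences. -/
def V : Submodule ℂ (ℕ → ℂ) :=
  Submodule.span ℂ {u | ∃ x c : ℂ, ‖x‖ ≤ 1 ∧ u = vSeq x c}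

/-- The elements of `V` are bounded sequences. -/
theorem memℓp_of_mem_V {u : ℕ → ℂ} (hu : u ∈ V) : Memℓp u ⊤ := by
  have hle : V ≤ lpSubmodule ℂ (fun _ : ℕ => ℂ) ⊤ := by
    refine Submodule.span_le.2 ?_
    rintro _ ⟨x, c, hx, rfl⟩
    refine memℓp_infty ⟨max ‖c‖ 1, ?_⟩
    rintro _ ⟨n, rfl⟩
    by_cases hn : n = 0
    · simp [vSeq, hn]
    · have h1 : (1 : ℝ) ≤ n := by exact_mod_cast Nat.one_le_iff_ne_zero.2 hn
      have h2 : ‖x‖ ^ n ≤ 1 := pow_le_one₀ (norm_nonneg x) hx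
      refine le_trans ?_ (le_max_right _ _)
      simp only [vSeq, hn, if_false, norm_neg, norm_div, norm_pow, Complex.norm_natCast]
      exact div_le_one_of_le₀ (h2.trans h1) (by positivity)
  exact hle hu

/-- `T : V → V` is the operator of the infinite matrix `b`: for all `u ∈ V` and all `k`, the series
`∑ n, b k n * u n` converges (as a limit of partial sums) and its sum is `(T u) k`. -/
def IsOperatorOf (b : ℕ → ℕ → ℝ) (T : V →ₗ[ℂ] V) : Prop :=
  ∀ (u : V) (k : ℕ),
    Tendsto (fun N : ℕ => ∑ n ∈ Finset.range N, (b k n : ℂ) * (u : ℕ → ℂ) n) atTop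
      (𝓝 ((T u : ℕ → ℂ) k))

/-- The matrix `F(A)`: the action of `A` on the simplex, read in the coordinate `x ∈ [-1, 1]` of the
vector `((1 + x) / 2, (1 - x) / 2)`, is the Möbius map of `F(A)`. -/
def F (A : Matrix (Fin 2) (Fin 2) ℝ) : Matrix (Fin 2) (Fin 2) ℝ :=
  (1 / 2 : ℝ) •
    !![A 0 0 - A 0 1 - A 1 0 + A 1 1, A 0 0 + A 0 1 - A 1 0 - A 1 1;
       A 0 0 - A 0 1 + A 1 0 - A 1 1, A 0 0 + A 0 1 + A 1 0 + A 1 1]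

/-- The Möbius map of a real matrix, on real arguments away from its pole. -/
def mobius (G : Matrix (Fin 2) (Fin 2) ℝ) (x : ℝ) : ℝ :=
  (G 0 0 * x + G 0 1) / (G 1 0 * x + G 1 1)

variable {I : Type*} [Fintype I]

/-- The vector `∑ i, w i • v(f_i(0) ; (1/2) log (det F(A_i) / f_i'(0)))`. -/
def vVec (A : I → Matrix (Fin 2) (Fin 2) ℝ) (w : I → ℝ) : ℕ → ℂ :=
  ∑ i, (w i : ℂ) •
    vSeq ((mobius (F (A i)) 0 : ℝ) : ℂ)
      ((1 / 2 * Real.log ((F (A i)).det / deriv (mobius (F (A i))) 0) : ℝ) : ℂ)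

/-- The entry `b_{k,n}` of the infinite matrix attached to the matrices `A i` and weights `w i`. -/
def bCoeff (A : I → Matrix (Fin 2) (Fin 2) ℝ) (w : I → ℝ) (k n : ℕ) : ℝ :=
  if n = 0 then 0
  else if k = 0 then ∑ i, w i * mobius (F (A i))ᵀ 0 ^ n
  else ∑ i, w i * ∑ l ∈ Finset.Icc 1 (min k n),
    (n.choose l : ℝ) * ((k - 1).choose (l - 1) : ℝ) * mobius (F (A i))ᵀ 0 ^ (n - l) *
      (-mobius (F (A i)) 0) ^ (k - l) * deriv (mobius (F (A i))) 0 ^ l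

/-- The matrix `M` of one step of the recurrence with coefficients `a`, `b`. -/
def stepMatrix (a b : ℝ) : Matrix (Fin 2) (Fin 2) ℝ :=
  !![0, 1; b, a]

/-- `x_0 = x_1 = 1` and `x_{n+1} = a_{i_{n+1}} x_n + b_{i_{n+1}} x_{n-1}` for an index sequence
`i_0, i_1, i_2, …` (of which `i_0` and `i_1` are not used). -/
def recSeq {J : Type*} (a b : J → ℝ) (i : ℕ → J) : ℕ → ℝ
  | 0 => 1
  | 1 => 1
  | n + 2 => a (i (n + 2)) * recSeq a b i (n + 1) + b (i (n + 2)) * recSeq a b i n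

end ThreeTerm

end

/-! Read `vSeq x c` as the Taylor coefficients of c + log(1 + xz). For a single matrix, the infinite
matrix drops the constant term and composes with the Möbius map f^⊤. Since 1 + x f^⊤(z) = (1 + x
f^⊤(0)) (1 + f(x) z) / (1 + f(0) z), it sends v(x; c) to v(f(x); log(1 + x f^⊤(0))) - v(f(0); 0).
Adding v cancels the subtracted term up to its entry 0, so the partial sums of ∑ T^k v are averages
over words (`sum_pow_operator_eq_wordAvg`). With |B| the sum of the entries of B, their entry 0 is
the increment of the mean of log |B| over products B of N matrices (`sum_pow_operator_apply_zero`).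

These increments converge to some S: their successive differences are means of logarithms of |A_i B
A_j| |B| / (|A_i B| |B A_j|), which is geometrically close to 1 because |det B| / perm B decays
geometrically (`abs_logAvg_second_difference_le`).

Almost surely, log |B| also grows at rate S along the random product: it is additive under
concatenation up to a bounded error, so the strong law on long blocks suffices
(`ae_tendsto_block_average`, `tendsto_apply_seqWord_div`). Finally x_n is a row sum of a product of
⌊n/2⌋ pair matrices and is comparable with |B|, whence the factor 1/2. -/

namespace ThreeTerm

/-! ### Logarithmic sequences under composition matrices -/

theorem vSeq_zero (x c : ℂ) : vSeq x c 0 = c := rfl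

theorem vSeq_of_ne_zero (x c : ℂ) {n : ℕ} (hn : n ≠ 0) :
    vSeq x c n = -((-x) ^ n / (n : ℂ)) := if_neg hn

/-- Both sides are the coefficient of t^(l+1) in log(1 + x(y + t)); absorbing the denominator n into
the binomial leaves a differentiated geometric series in -xy. -/
theorem hasSum_choose_mul_vSeq {x y : ℂ} (c : ℂ) (h : ‖x * y‖ < 1) (l : ℕ) :
    HasSum (fun n : ℕ => (n.choose (l + 1) : ℂ) * y ^ (n - (l + 1)) * vSeq x c n)
      (-((-x) / (1 + x * y)) ^ (l + 1) / ((l + 1 : ℕ) : ℂ)) := by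
  have h0 := (hasSum_choose_mul_geometric_of_norm_lt_one l (r := -(x * y))
    (by rwa [norm_neg])).mul_left (-(-x) ^ (l + 1) / ((l + 1 : ℕ) : ℂ))
  rw [← hasSum_nat_add_iff' (l + 1), Finset.sum_eq_zero, sub_zero]
  · convert! h0 using 1
    · funext n
      have h1 : ((n + (l + 1)).choose (l + 1) : ℂ) * ((l + 1 : ℕ) : ℂ) =
          ((n + (l + 1) : ℕ) : ℂ) * ((n + l).choose l : ℂ) := by
        exact_mod_cast (Nat.add_one_mul_choose_eq (n + l) l).symm
      have h2 : ((l + 1 : ℕ) : ℂ) ≠ 0 := Nat.cast_ne_zero.2 l.succ_ne_zero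
      have h3 : ((n + (l + 1) : ℕ) : ℂ) ≠ 0 := Nat.cast_ne_zero.2 (by omega)
      rw [vSeq_of_ne_zero _ _ (by omega), Nat.add_sub_cancel,
        show -(x * y) = (-x) * y by ring, mul_pow, pow_add (-x) n]
      field_simp
      linear_combination (-((-x) ^ n * (-x) ^ (l + 1) * y ^ n)) * h1
    · rw [sub_neg_eq_add, div_pow]
      ring
  · intro n hn
    rw [Nat.choose_eq_zero_of_lt (Finset.mem_range.1 hn)]
    simp

/-- The sum of row `k ≥ 1` of the composition matrix of `z ↦ y + d z / (1 + g z)` against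
`v(x ; c)`. -/
theorem hasSum_row_mul_vSeq {x y : ℂ} (c g d : ℂ) (h : ‖x * y‖ < 1) {k : ℕ} (hk : k ≠ 0) :
    HasSum (fun n : ℕ => (∑ l ∈ Finset.Icc 1 (min k n),
        (n.choose l : ℂ) * ((k - 1).choose (l - 1) : ℂ) * y ^ (n - l) * (-g) ^ (k - l) * d ^ l) *
          vSeq x c n)
      (vSeq (g + x * d / (1 + x * y)) 0 k - vSeq g 0 k) := by
  obtain ⟨k, rfl⟩ := Nat.exists_eq_succ_of_ne_zero hk
  have key : ∀ l ∈ Finset.range (k + 1), HasSum (fun n : ℕ =>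
      (k.choose l : ℂ) * (-g) ^ (k - l) * d ^ (l + 1) *
        ((n.choose (l + 1) : ℂ) * y ^ (n - (l + 1)) * vSeq x c n))
      ((k.choose l : ℂ) * (-g) ^ (k - l) * d ^ (l + 1) *
        (-((-x) / (1 + x * y)) ^ (l + 1) / ((l + 1 : ℕ) : ℂ))) :=
    fun l _ => (hasSum_choose_mul_vSeq c h l).mul_left _
  convert! hasSum_sum key using 1
  · funext n
    -- The binomial vanishes for l > n, so the range of l can be made independent of n, which allows
    -- the two sums to be exchanged.
    have hsub : ∑ l ∈ Finset.Icc 1 (min (k + 1) n),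
        (n.choose l : ℂ) * ((k + 1 - 1).choose (l - 1) : ℂ) * y ^ (n - l) *
          (-g) ^ (k + 1 - l) * d ^ l =
        ∑ l ∈ Finset.Icc 1 (k + 1),
        (n.choose l : ℂ) * ((k + 1 - 1).choose (l - 1) : ℂ) * y ^ (n - l) *
          (-g) ^ (k + 1 - l) * d ^ l := by
      refine Finset.sum_subset (Finset.Icc_subset_Icc_right (min_le_left _ _)) ?_
      intro l hl hl'
      simp only [Finset.mem_Icc, le_min_iff, not_and, not_le] at hl hl'
      rw [Nat.choose_eq_zero_of_lt (hl' hl.1 hl.2)]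
      simp
    have hIcc : Finset.Icc 1 (k + 1) = Finset.Ico 1 (k + 1 + 1) := by
      ext l
      simp
    rw [Nat.succ_eq_add_one, hsub, hIcc, Finset.sum_Ico_eq_sum_range, Finset.sum_mul]
    refine Finset.sum_congr rfl fun l _ => ?_
    rw [add_comm 1 l, Nat.add_sub_cancel, Nat.add_sub_cancel, Nat.add_sub_add_right]
    ring
  · have hk1 : ((k + 1 : ℕ) : ℂ) ≠ 0 := Nat.cast_ne_zero.2 k.succ_ne_zero
    -- Binomial expansion of the k-th power of the new point; its term without d is the subtracted
    -- v(g; 0).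
    rw [vSeq_of_ne_zero _ _ hk, vSeq_of_ne_zero _ _ hk, Nat.succ_eq_add_one,
      show -(g + x * d / (1 + x * y)) = (-x) / (1 + x * y) * d + -g by ring, add_pow,
      Finset.sum_range_succ']
    simp only [pow_zero, Nat.sub_zero, Nat.choose_zero_right, Nat.cast_one, one_mul, mul_one]
    rw [add_div, neg_add, add_sub_assoc, sub_neg_eq_add, neg_add_cancel, add_zero,
      Finset.sum_div, ← Finset.sum_neg_distrib]
    refine Finset.sum_congr rfl fun l _ => ?_
    have hl1 : ((l + 1 : ℕ) : ℂ) ≠ 0 := Nat.cast_ne_zero.2 l.succ_ne_zero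
    have h1 : ((k + 1 : ℕ) : ℂ) * (k.choose l : ℂ) =
        ((k + 1).choose (l + 1) : ℂ) * ((l + 1 : ℕ) : ℂ) := by
      exact_mod_cast Nat.add_one_mul_choose_eq k l
    rw [Nat.add_sub_add_right, mul_pow]
    field_simp
    linear_combination ((-x / (1 + x * y)) ^ (l + 1) * d ^ (l + 1) * (-g) ^ (k - l)) * h1

/-! ### The Möbius maps of F(A) on the closed unit disc -/

theorem F_zero_zero (A : Matrix (Fin 2) (Fin 2) ℝ) :
    F A 0 0 = (A 0 0 - A 0 1 - A 1 0 + A 1 1) / 2 := by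
  simp [F]; ring

theorem F_zero_one (A : Matrix (Fin 2) (Fin 2) ℝ) :
    F A 0 1 = (A 0 0 + A 0 1 - A 1 0 - A 1 1) / 2 := by
  simp [F]; ring

theorem F_one_zero (A : Matrix (Fin 2) (Fin 2) ℝ) :
    F A 1 0 = (A 0 0 - A 0 1 + A 1 0 - A 1 1) / 2 := by
  simp [F]; ring

theorem F_one_one (A : Matrix (Fin 2) (Fin 2) ℝ) :
    F A 1 1 = (A 0 0 + A 0 1 + A 1 0 + A 1 1) / 2 := by
  simp [F]; ring

theorem det_F (A : Matrix (Fin 2) (Fin 2) ℝ) : (F A).det = A.det := by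
  rw [det_fin_two, det_fin_two, F_zero_zero, F_zero_one, F_one_zero, F_one_one]
  ring

theorem mobius_zero (G : Matrix (Fin 2) (Fin 2) ℝ) : mobius G 0 = G 0 1 / G 1 1 := by
  simp [mobius]

theorem deriv_mobius_zero (G : Matrix (Fin 2) (Fin 2) ℝ) (h : G 1 1 ≠ 0) :
    deriv (mobius G) 0 = G.det / G 1 1 ^ 2 := by
  have h1 : HasDerivAt (fun x : ℝ => G 0 0 * x + G 0 1) (G 0 0) 0 := by
    simpa using ((hasDerivAt_id (0 : ℝ)).const_mul (G 0 0)).add_const (G 0 1)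
  have h2 : HasDerivAt (fun x : ℝ => G 1 0 * x + G 1 1) (G 1 0) 0 := by
    simpa using ((hasDerivAt_id (0 : ℝ)).const_mul (G 1 0)).add_const (G 1 1)
  have h3 := (h1.div h2 (by simpa using h)).deriv
  rw [show mobius G = (fun x : ℝ => G 0 0 * x + G 0 1) / fun x : ℝ => G 1 0 * x + G 1 1 from rfl,
    h3, det_fin_two]
  simp

/-- The Möbius map of a real matrix on complex arguments. -/
noncomputable def cmobius (G : Matrix (Fin 2) (Fin 2) ℝ) (x : ℂ) : ℂ :=
  (G 0 0 * x + G 0 1) / (G 1 0 * x + G 1 1)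

theorem ofReal_mobius (G : Matrix (Fin 2) (Fin 2) ℝ) (x : ℝ) :
    ((mobius G x : ℝ) : ℂ) = cmobius G x := by
  simp [mobius, cmobius]

section Positive

variable {A : Matrix (Fin 2) (Fin 2) ℝ} (hA : ∀ p q, 0 < A p q)

include hA

theorem F_one_one_pos : 0 < F A 1 1 := by
  rw [F_one_one]
  linarith [hA 0 0, hA 0 1, hA 1 0, hA 1 1]

theorem abs_F_one_zero_lt : |F A 1 0| < F A 1 1 := by
  rw [F_one_one, F_one_zero, abs_lt]
  constructor <;> linarith [hA 0 0, hA 0 1, hA 1 0, hA 1 1]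

theorem abs_mobius_transpose_lt_one : |mobius (F A)ᵀ 0| < 1 := by
  rw [mobius_zero, transpose_apply, transpose_apply, abs_div, abs_of_pos (F_one_one_pos hA),
    div_lt_one (F_one_one_pos hA)]
  exact abs_F_one_zero_lt hA

theorem denom_ne_zero {x : ℂ} (hx : ‖x‖ ≤ 1) : (F A 1 0 * x + F A 1 1 : ℂ) ≠ 0 := by
  intro h
  have h1 : ‖(F A 1 0 * x : ℂ)‖ = F A 1 1 := by
    rw [eq_neg_of_add_eq_zero_left h, norm_neg, Complex.norm_real, Real.norm_eq_abs,
      abs_of_pos (F_one_one_pos hA)]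
  rw [norm_mul, Complex.norm_real, Real.norm_eq_abs] at h1
  have h2 := abs_F_one_zero_lt hA
  nlinarith [abs_nonneg (F A 1 0), norm_nonneg x]

/-- With N and D the numerator and denominator, D + N = A₀₀(1+x) + A₀₁(1-x) and D - N = A₁₀(1+x) +
A₁₁(1-x). Hence |D|² - |N|² = Re((D+N) conj(D-N)) is the sum of the three nonnegative terms `e1`,
`e2`, `e3`. -/
theorem norm_cmobius_le_one {x : ℂ} (hx : ‖x‖ ≤ 1) : ‖cmobius (F A) x‖ ≤ 1 := by
  rw [cmobius, norm_div]
  refine div_le_one_of_le₀ ?_ (norm_nonneg _)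
  rw [← sq_le_sq₀ (norm_nonneg _) (norm_nonneg _), ← Complex.normSq_eq_norm_sq,
    ← Complex.normSq_eq_norm_sq]
  have h1 : x.re * x.re + x.im * x.im ≤ 1 := by
    rw [← Complex.normSq_apply, Complex.normSq_eq_norm_sq]
    nlinarith [norm_nonneg x]
  simp only [Complex.normSq_apply, Complex.add_re, Complex.mul_re, Complex.ofReal_re,
    Complex.ofReal_im, Complex.add_im, Complex.mul_im, zero_mul, sub_zero, add_zero]
  rw [F_zero_zero, F_zero_one, F_one_zero, F_one_one]
  have h00 := hA 0 0
  have h01 := hA 0 1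
  have h10 := hA 1 0
  have h11 := hA 1 1
  have e1 : 0 ≤ A 0 0 * A 1 0 * ((1 + x.re) ^ 2 + x.im ^ 2) := by positivity
  have e2 : 0 ≤ A 0 1 * A 1 1 * ((1 - x.re) ^ 2 + x.im ^ 2) := by positivity
  have e3 : 0 ≤ (A 0 0 * A 1 1 + A 0 1 * A 1 0) * (1 - (x.re * x.re + x.im * x.im)) :=
    mul_nonneg (by positivity) (by linarith)
  linarith

/-- The Möbius map in terms of its value and derivative at `0` and the value of the transposed map. -/
theorem cmobius_eq {x : ℂ} (hx : ‖x‖ ≤ 1) :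
    cmobius (F A) x = (mobius (F A) 0 : ℂ) +
      x * (deriv (mobius (F A)) 0 : ℝ) / (1 + x * (mobius (F A)ᵀ 0 : ℝ)) := by
  have h0 : (F A 1 1 : ℂ) ≠ 0 := Complex.ofReal_ne_zero.2 (F_one_one_pos hA).ne'
  have h1 := denom_ne_zero hA hx
  have h2 : (1 + x * (F A 1 0 / F A 1 1) : ℂ) ≠ 0 := by
    intro h
    apply h1
    field_simp at h
    linear_combination h
  rw [deriv_mobius_zero _ (F_one_one_pos hA).ne', mobius_zero, mobius_zero, transpose_apply,
    transpose_apply, det_fin_two, cmobius]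
  push_cast
  have h3 : (F A 1 1 + x * F A 1 0 : ℂ) ≠ 0 := by rwa [add_comm, mul_comm]
  rw [div_eq_iff h1]
  field_simp
  ring

end Positive

/-! ### The operator T on V -/

/-- The contribution of one matrix to the entry `b_{k,n}`. -/
noncomputable def rowEntry (A : Matrix (Fin 2) (Fin 2) ℝ) (k n : ℕ) : ℝ :=
  if n = 0 then 0
  else if k = 0 then mobius (F A)ᵀ 0 ^ n
  else ∑ l ∈ Finset.Icc 1 (min k n),
    (n.choose l : ℝ) * ((k - 1).choose (l - 1) : ℝ) * mobius (F A)ᵀ 0 ^ (n - l) *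
      (-mobius (F A) 0) ^ (k - l) * deriv (mobius (F A)) 0 ^ l

theorem bCoeff_eq_sum {I : Type*} [Fintype I] (A : I → Matrix (Fin 2) (Fin 2) ℝ) (w : I → ℝ)
    (k n : ℕ) : bCoeff A w k n = ∑ i, w i * rowEntry (A i) k n := by
  unfold bCoeff rowEntry
  split_ifs <;> simp

/-- The image of `v(x ; c)` under the operator of a single matrix. -/
noncomputable def vImage (A : Matrix (Fin 2) (Fin 2) ℝ) (x : ℂ) : ℕ → ℂ :=
  vSeq (cmobius (F A) x) (Complex.log (1 + x * (mobius (F A)ᵀ 0 : ℝ))) -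
    vSeq (mobius (F A) 0 : ℝ) 0

theorem hasSum_rowEntry_mul_vSeq {A : Matrix (Fin 2) (Fin 2) ℝ} (hA : ∀ p q, 0 < A p q)
    {x : ℂ} (hx : ‖x‖ ≤ 1) (c : ℂ) (k : ℕ) :
    HasSum (fun n => (rowEntry A k n : ℂ) * vSeq x c n) (vImage A x k) := by
  have hxy : ‖x * (mobius (F A)ᵀ 0 : ℝ)‖ < 1 := by
    rw [norm_mul, Complex.norm_real, Real.norm_eq_abs]
    have h1 := abs_mobius_transpose_lt_one hA
    nlinarith [abs_nonneg (mobius (F A)ᵀ 0), norm_nonneg x]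
  rcases eq_or_ne k 0 with rfl | hk
  · have h := (Complex.hasSum_taylorSeries_log hxy)
    convert! h using 1
    · funext n
      rcases eq_or_ne n 0 with rfl | hn
      · simp [rowEntry]
      · rw [vSeq_of_ne_zero _ _ hn, rowEntry, if_neg hn, if_pos rfl, neg_pow x, mul_pow]
        push_cast
        ring
    · simp [vImage, vSeq_zero]
  · have h := hasSum_row_mul_vSeq c (mobius (F A) 0 : ℝ) (deriv (mobius (F A)) 0 : ℝ) hxy hk
    convert! h using 1
    · funext n
      congr 1
      rcases eq_or_ne n 0 with rfl | hn
      · simp [rowEntry]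
      · rw [rowEntry, if_neg hn, if_neg hk]
        push_cast
        rfl
    · rw [← cmobius_eq hA hx, vImage, Pi.sub_apply, vSeq_of_ne_zero _ _ hk, vSeq_of_ne_zero _ _ hk,
        vSeq_of_ne_zero _ _ hk]

theorem hasSum_bCoeff_mul_vSeq {I : Type*} [Fintype I] {A : I → Matrix (Fin 2) (Fin 2) ℝ}
    (hA : ∀ i p q, 0 < A i p q) (w : I → ℝ) {x : ℂ} (hx : ‖x‖ ≤ 1) (c : ℂ) (k : ℕ) :
    HasSum (fun n => (bCoeff A w k n : ℂ) * vSeq x c n) ((∑ i, (w i : ℂ) • vImage (A i) x) k) := by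
  have h := hasSum_sum (s := Finset.univ) fun i _ =>
    (hasSum_rowEntry_mul_vSeq (hA i) hx c k).mul_left (w i : ℂ)
  convert! h using 1
  · funext n
    rw [bCoeff_eq_sum, Complex.ofReal_sum, Finset.sum_mul]
    refine Finset.sum_congr rfl fun i _ => ?_
    push_cast
    ring
  · simp

theorem vSeq_mem_V {x : ℂ} (hx : ‖x‖ ≤ 1) (c : ℂ) : vSeq x c ∈ V :=
  Submodule.subset_span ⟨x, c, hx, rfl⟩

theorem norm_mobius_zero_le_one {A : Matrix (Fin 2) (Fin 2) ℝ} (hA : ∀ p q, 0 < A p q) :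
    ‖((mobius (F A) 0 : ℝ) : ℂ)‖ ≤ 1 := by
  rw [ofReal_mobius]
  exact norm_cmobius_le_one hA (by simp)

theorem vImage_mem_V {A : Matrix (Fin 2) (Fin 2) ℝ} (hA : ∀ p q, 0 < A p q)
    {x : ℂ} (hx : ‖x‖ ≤ 1) : vImage A x ∈ V :=
  V.sub_mem (vSeq_mem_V (norm_cmobius_le_one hA hx) _)
    (vSeq_mem_V (norm_mobius_zero_le_one hA) _)

/-- The operator of the matrix `b_{k,n}` on `V`, together with its unconditional convergence. -/
theorem exists_operator {I : Type*} [Fintype I] {A : I → Matrix (Fin 2) (Fin 2) ℝ}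
    (hA : ∀ i p q, 0 < A i p q) (w : I → ℝ) :
    ∃ T : V →ₗ[ℂ] V, ∀ (u : V) (k : ℕ),
      HasSum (fun n => (bCoeff A w k n : ℂ) * (u : ℕ → ℂ) n) ((T u : ℕ → ℂ) k) := by
  -- The generators of V need not be independent, so T is defined by the sums of the series;
  -- uniqueness of sums then gives linearity.
  have key : ∀ u ∈ V, ∃ t ∈ V, ∀ k, HasSum (fun n => (bCoeff A w k n : ℂ) * u n) (t k) := by
    intro u hu
    induction hu using Submodule.span_induction with
    | mem u hu =>
      obtain ⟨x, c, hx, rfl⟩ := hu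
      exact ⟨_, V.sum_mem fun i _ => V.smul_mem _ (vImage_mem_V (hA i) hx),
        hasSum_bCoeff_mul_vSeq hA w hx c⟩
    | zero => exact ⟨0, V.zero_mem, fun k => by simp⟩
    | add u₁ u₂ _ _ h₁ h₂ =>
      obtain ⟨t₁, m₁, h₁⟩ := h₁
      obtain ⟨t₂, m₂, h₂⟩ := h₂
      refine ⟨t₁ + t₂, V.add_mem m₁ m₂, fun k => ?_⟩
      simpa only [Pi.add_apply, mul_add] using (h₁ k).add (h₂ k)
    | smul a u _ h =>
      obtain ⟨t, m, h⟩ := h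
      refine ⟨a • t, V.smul_mem a m, fun k => ?_⟩
      simpa only [Pi.smul_apply, smul_eq_mul, mul_left_comm] using (h k).mul_left a
  choose! t hmem ht using key
  refine ⟨{ toFun := fun u => ⟨t u, hmem u u.2⟩, map_add' := ?_, map_smul' := ?_ },
    fun u k => ht u u.2 k⟩
  · intro u₁ u₂
    ext k
    refine (ht _ (u₁ + u₂).2 k).unique ?_
    simpa only [Submodule.coe_add, Pi.add_apply, mul_add] using
      (ht u₁ u₁.2 k).add (ht u₂ u₂.2 k)
  · intro a u
    ext k
    refine (ht _ (a • u).2 k).unique ?_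
    simpa only [Submodule.coe_smul, Pi.smul_apply, smul_eq_mul, mul_left_comm, RingHom.id_apply]
      using (ht u u.2 k).mul_left a

/-! ### Averages over words -/

section WordAvg

variable {I : Type*} [Fintype I] {E E' : Type*} [AddCommGroup E] [Module ℝ E]
  [AddCommGroup E'] [Module ℝ E']

/-- The average of `φ` over all words of length `n`, the letters having weights `w`. -/
noncomputable def wordAvg (w : I → ℝ) : ℕ → (List I → E) → E
  | 0, φ => φ []
  | n + 1, φ => ∑ i, w i • wordAvg w n fun l => φ (i :: l)

theorem map_wordAvg (w : I → ℝ) (L : E →ₗ[ℝ] E') (n : ℕ) (φ : List I → E) :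
    L (wordAvg w n φ) = wordAvg w n fun l => L (φ l) := by
  induction n generalizing φ with
  | zero => rfl
  | succ n ih => simp only [wordAvg, map_sum, map_smul, ih]

theorem wordAvg_const (w : I → ℝ) (hw : ∑ i, w i = 1) (n : ℕ) (c : E) :
    wordAvg w n (fun _ => c) = c := by
  induction n with
  | zero => rfl
  | succ n ih => simp only [wordAvg, ih, ← Finset.sum_smul, hw, one_smul]

theorem wordAvg_add (w : I → ℝ) (n : ℕ) (φ ψ : List I → E) :
    wordAvg w n (fun l => φ l + ψ l) = wordAvg w n φ + wordAvg w n ψ := by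
  induction n generalizing φ ψ with
  | zero => rfl
  | succ n ih => simp only [wordAvg, ih, smul_add, Finset.sum_add_distrib]

theorem wordAvg_smul (w : I → ℝ) (n : ℕ) (c : ℝ) (φ : List I → E) :
    wordAvg w n (fun l => c • φ l) = c • wordAvg w n φ :=
  (map_wordAvg w (c • LinearMap.id) n φ).symm

theorem wordAvg_sub (w : I → ℝ) (n : ℕ) (φ ψ : List I → E) :
    wordAvg w n (fun l => φ l - ψ l) = wordAvg w n φ - wordAvg w n ψ := by
  induction n generalizing φ ψ with
  | zero => rfl
  | succ n ih => simp only [wordAvg, ih, smul_sub, Finset.sum_sub_distrib]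

theorem wordAvg_sum {J : Type*} (s : Finset J) (w : I → ℝ) (n : ℕ) (φ : J → List I → E) :
    wordAvg w n (fun l => ∑ j ∈ s, φ j l) = ∑ j ∈ s, wordAvg w n (φ j) := by
  induction n generalizing φ with
  | zero => rfl
  | succ n ih =>
    simp only [wordAvg, ih, Finset.smul_sum]
    exact Finset.sum_comm

theorem wordAvg_sum_cons (w : I → ℝ) (n : ℕ) (φ : List I → E) :
    wordAvg w n (fun l => ∑ i, w i • φ (i :: l)) = wordAvg w (n + 1) φ := by
  rw [wordAvg_sum]
  simp only [wordAvg_smul]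
  rfl

/-- The weight of a word is a product, so the additional letter may equally be drawn at the right
end. -/
theorem wordAvg_sum_concat (w : I → ℝ) (n : ℕ) (φ : List I → E) :
    wordAvg w n (fun l => ∑ i, w i • φ (l ++ [i])) = wordAvg w (n + 1) φ := by
  induction n generalizing φ with
  | zero => rfl
  | succ n ih =>
    exact Finset.sum_congr rfl fun i _ => congrArg (w i • ·) (ih fun l => φ (i :: l))

theorem abs_wordAvg_le {w : I → ℝ} (hw : ∀ i, 0 ≤ w i) (hw1 : ∑ i, w i = 1) (n : ℕ)
    {φ : List I → ℝ} {C : ℝ} (hφ : ∀ l : List I, l.length = n → |φ l| ≤ C) :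
    |wordAvg w n φ| ≤ C := by
  induction n generalizing φ with
  | zero => exact hφ [] rfl
  | succ n ih =>
    calc |wordAvg w (n + 1) φ| ≤ ∑ i, |w i • wordAvg w n fun l => φ (i :: l)| :=
          Finset.abs_sum_le_sum_abs _ _
      _ ≤ ∑ i, w i * C := Finset.sum_le_sum fun i _ => by
          rw [smul_eq_mul, abs_mul, abs_of_nonneg (hw i)]
          exact mul_le_mul_of_nonneg_left (ih fun l hl => hφ _ (by simp [hl])) (hw i)
      _ = C := by rw [← Finset.sum_mul, hw1, one_mul]

end WordAvg

/-! ### Entry sums of products and the partial sums of ∑ T^k v -/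

section Matrices

/-- The sum of the entries. -/
def entrySum (B : Matrix (Fin 2) (Fin 2) ℝ) : ℝ :=
  B 0 0 + B 0 1 + (B 1 0 + B 1 1)

/-- Nonnegative matrices with positive row sums. -/
def IsAllowable (B : Matrix (Fin 2) (Fin 2) ℝ) : Prop :=
  (∀ p q, 0 ≤ B p q) ∧ ∀ p, 0 < B p 0 + B p 1

theorem isAllowable_one : IsAllowable 1 := by
  refine ⟨fun p q => ?_, Fin.forall_fin_two.2 ⟨by simp, by simp⟩⟩
  fin_cases p <;> fin_cases q <;> simp

theorem IsAllowable.mul {A B : Matrix (Fin 2) (Fin 2) ℝ} (hA : IsAllowable A)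
    (hB : IsAllowable B) : IsAllowable (A * B) := by
  refine ⟨fun p q => ?_, fun p => ?_⟩
  · rw [mul_apply, Fin.sum_univ_two]
    exact add_nonneg (mul_nonneg (hA.1 _ _) (hB.1 _ _)) (mul_nonneg (hA.1 _ _) (hB.1 _ _))
  · have h : (A * B) p 0 + (A * B) p 1 =
        A p 0 * (B 0 0 + B 0 1) + A p 1 * (B 1 0 + B 1 1) := by
      simp only [mul_apply, Fin.sum_univ_two]
      ring
    rw [h]
    rcases (hA.1 p 0).lt_or_eq with h0 | h0
    · exact add_pos_of_pos_of_nonneg (mul_pos h0 (hB.2 0)) (mul_nonneg (hA.1 _ _) (hB.2 1).le)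
    · refine add_pos_of_nonneg_of_pos (mul_nonneg (hA.1 _ _) (hB.2 0).le) (mul_pos ?_ (hB.2 1))
      have := hA.2 p
      rwa [← h0, zero_add] at this

theorem isAllowable_of_pos {A : Matrix (Fin 2) (Fin 2) ℝ} (hA : ∀ p q, 0 < A p q) :
    IsAllowable A :=
  ⟨fun p q => (hA p q).le, fun p => add_pos (hA p 0) (hA p 1)⟩

theorem IsAllowable.entrySum_pos {B : Matrix (Fin 2) (Fin 2) ℝ} (hB : IsAllowable B) :
    0 < entrySum B :=
  add_pos (hB.2 0) (hB.2 1)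

/-- The coordinate 0 is the midpoint of the simplex, so the value is the direction of B(1,1)ᵀ, a
vector of total mass `entrySum B`. -/
theorem mobius_F_zero (B : Matrix (Fin 2) (Fin 2) ℝ) :
    mobius (F B) 0 = (B 0 0 + B 0 1 - (B 1 0 + B 1 1)) / entrySum B := by
  rw [mobius_zero, F_zero_one, F_one_one, div_div_div_cancel_right₀ two_ne_zero, entrySum]
  congr 1 <;> ring

theorem IsAllowable.abs_mobius_F_zero_le_one {B : Matrix (Fin 2) (Fin 2) ℝ}
    (hB : IsAllowable B) : |mobius (F B) 0| ≤ 1 := by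
  rw [mobius_F_zero, abs_div, abs_of_pos hB.entrySum_pos, div_le_one hB.entrySum_pos, entrySum,
    abs_le]
  constructor <;> linarith [hB.2 0, hB.2 1]

/-- The denominator of the Möbius map is the factor by which A changes the total mass of the
normalized vector B(1,1)ᵀ. -/
theorem denom_mul_entrySum (A : Matrix (Fin 2) (Fin 2) ℝ) {B : Matrix (Fin 2) (Fin 2) ℝ}
    (hB : IsAllowable B) :
    F A 1 0 * mobius (F B) 0 + F A 1 1 = entrySum (A * B) / entrySum B := by
  have h := hB.entrySum_pos.ne'
  rw [eq_div_iff h, mobius_F_zero, F_one_zero, F_one_one, add_mul, mul_assoc,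
    div_mul_cancel₀ _ h]
  simp only [entrySum, mul_apply, Fin.sum_univ_two]
  ring

theorem mobius_F_mul {A B : Matrix (Fin 2) (Fin 2) ℝ} (hA : IsAllowable A)
    (hB : IsAllowable B) : mobius (F A) (mobius (F B) 0) = mobius (F (A * B)) 0 := by
  have h := hB.entrySum_pos.ne'
  have h' := (hA.mul hB).entrySum_pos.ne'
  rw [mobius, denom_mul_entrySum A hB, mobius_F_zero (A * B), mobius_F_zero B, F_zero_zero,
    F_zero_one]
  field_simp
  simp only [entrySum, mul_apply, Fin.sum_univ_two]
  ring

variable {I : Type*}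

/-- The product of the matrices of a word. -/
def wordProd (A : I → Matrix (Fin 2) (Fin 2) ℝ) (l : List I) : Matrix (Fin 2) (Fin 2) ℝ :=
  (l.map A).prod

theorem wordProd_cons (A : I → Matrix (Fin 2) (Fin 2) ℝ) (i : I) (l : List I) :
    wordProd A (i :: l) = A i * wordProd A l := by
  simp [wordProd]

theorem wordProd_append (A : I → Matrix (Fin 2) (Fin 2) ℝ) (l l' : List I) :
    wordProd A (l ++ l') = wordProd A l * wordProd A l' := by
  simp [wordProd]

theorem wordProd_singleton (A : I → Matrix (Fin 2) (Fin 2) ℝ) (i : I) :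
    wordProd A [i] = A i := by
  simp [wordProd]

theorem isAllowable_wordProd {A : I → Matrix (Fin 2) (Fin 2) ℝ} (hA : ∀ i p q, 0 < A i p q)
    (l : List I) : IsAllowable (wordProd A l) := by
  induction l with
  | nil => exact isAllowable_one
  | cons i l ih =>
    rw [wordProd_cons]
    exact (isAllowable_of_pos (hA i)).mul ih

/-- The summand `v(f_{il}(0) ; log (|A_i A_l| / |A_l|))` of the partial sums of `∑ T^k v`. -/
noncomputable def vWord (A : I → Matrix (Fin 2) (Fin 2) ℝ) (l : List I) (i : I) : ℕ → ℂ :=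
  vSeq (mobius (F (wordProd A (i :: l))) 0 : ℝ)
    (Real.log (entrySum (wordProd A (i :: l))) - Real.log (entrySum (wordProd A l)) : ℝ)

theorem vWord_mem_V {A : I → Matrix (Fin 2) (Fin 2) ℝ} (hA : ∀ i p q, 0 < A i p q)
    (l : List I) (i : I) : vWord A l i ∈ V := by
  refine vSeq_mem_V ?_ _
  rw [Complex.norm_real]
  exact (isAllowable_wordProd hA _).abs_mobius_F_zero_le_one

/-- The sequences at f_j(0) cancel away from entry 0. At entry 0, the denominator `F (A j) 1 1` in
the logarithm is |A_j| / |1|, which is exactly what `vWord A [] j` restores. -/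
theorem vImage_add_vWord {A : I → Matrix (Fin 2) (Fin 2) ℝ} (hA : ∀ i p q, 0 < A i p q)
    (l : List I) (j : I) :
    vImage (A j) (mobius (F (wordProd A l)) 0 : ℝ) + vWord A [] j = vWord A l j := by
  have hB := isAllowable_wordProd hA l
  have hAj := isAllowable_of_pos (hA j)
  have hs := hB.entrySum_pos
  have hs' := (hAj.mul hB).entrySum_pos
  have h1 := F_one_one_pos (hA j)
  have h2 : 1 + mobius (F (wordProd A l)) 0 * mobius (F (A j))ᵀ 0 =
      entrySum (A j * wordProd A l) / entrySum (wordProd A l) / F (A j) 1 1 := by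
    rw [← denom_mul_entrySum _ hB, mobius_zero (F (A j))ᵀ, transpose_apply, transpose_apply]
    field_simp
    ring
  have h3 : (1 + (mobius (F (wordProd A l)) 0 : ℝ) * (mobius (F (A j))ᵀ 0 : ℝ) : ℂ) =
      (entrySum (A j * wordProd A l) / entrySum (wordProd A l) / F (A j) 1 1 : ℝ) := by
    rw [← h2]
    push_cast
    rfl
  have h4 : F (A j) 1 1 = entrySum (A j) / entrySum 1 := by
    rw [F_one_one]
    norm_num [entrySum]
    ring
  have hsj := hAj.entrySum_pos
  have hs1 := isAllowable_one.entrySum_pos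
  unfold vImage vWord
  rw [← ofReal_mobius, mobius_F_mul hAj hB, wordProd_singleton, wordProd_cons, h3,
    ← Complex.ofReal_log (by positivity), Real.log_div (by positivity) (by positivity),
    Real.log_div (by positivity) (by positivity), h4, Real.log_div (by positivity) (by positivity),
    show wordProd A [] = 1 from rfl]
  funext k
  rcases eq_or_ne k 0 with rfl | hk
  · simp only [Pi.add_apply, Pi.sub_apply, vSeq_zero]
    push_cast
    ring
  · simp only [Pi.add_apply, Pi.sub_apply, vSeq_of_ne_zero _ _ hk]
    ring

variable [Fintype I]

/-- The average of the logarithms of the sums of entries of all products of length `n`. -/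
noncomputable def logAvg (A : I → Matrix (Fin 2) (Fin 2) ℝ) (w : I → ℝ) (n : ℕ) : ℝ :=
  wordAvg w n fun l => Real.log (entrySum (wordProd A l))

theorem vVec_eq_sum_vWord {A : I → Matrix (Fin 2) (Fin 2) ℝ} (hA : ∀ i p q, 0 < A i p q)
    (hdet : ∀ i, (A i).det ≠ 0) (w : I → ℝ) :
    vVec A w = ∑ i, (w i : ℂ) • vWord A [] i := by
  unfold vVec vWord
  refine Finset.sum_congr rfl fun i _ => ?_
  have h1 := F_one_one_pos (hA i)
  -- The derivative is det / F₁₁², so half the logarithm is log F₁₁. A zero determinant would give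
  -- 0/0 = 0 instead.
  have h2 : (F (A i)).det / deriv (mobius (F (A i))) 0 = F (A i) 1 1 ^ 2 := by
    rw [deriv_mobius_zero _ h1.ne', det_F]
    have := hdet i
    field_simp
  have h3 : F (A i) 1 1 = entrySum (A i) / entrySum 1 := by
    rw [F_one_one]
    norm_num [entrySum]
    ring
  rw [h2, wordProd_singleton, Real.log_pow, h3,
    Real.log_div (isAllowable_of_pos (hA i)).entrySum_pos.ne' isAllowable_one.entrySum_pos.ne']
  congr 4
  push_cast
  rw [show wordProd A [] = 1 from rfl]
  ring

theorem vVec_mem_V {A : I → Matrix (Fin 2) (Fin 2) ℝ} (hA : ∀ i p q, 0 < A i p q) (w : I → ℝ) :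
    vVec A w ∈ V :=
  V.sum_mem fun i _ => V.smul_mem _ (vSeq_mem_V (norm_mobius_zero_le_one (hA i)) _)

/-- The partial sums of `∑ T^k v` as averages over words. -/
theorem sum_pow_operator_eq_wordAvg {A : I → Matrix (Fin 2) (Fin 2) ℝ}
    (hA : ∀ i p q, 0 < A i p q) (hdet : ∀ i, (A i).det ≠ 0) {w : I → ℝ} (hw : ∑ i, w i = 1)
    {T : V →ₗ[ℂ] V} (hT : ∀ (u : V) (k : ℕ),
      HasSum (fun n => (bCoeff A w k n : ℂ) * (u : ℕ → ℂ) n) ((T u : ℕ → ℂ) k)) (N : ℕ) :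
    ∑ k ∈ Finset.range (N + 1), (T ^ k) ⟨vVec A w, vVec_mem_V hA w⟩ =
      wordAvg w N fun l => ∑ j, w j • (⟨vWord A l j, vWord_mem_V hA l j⟩ : V) := by
  have hv : (⟨vVec A w, vVec_mem_V hA w⟩ : V) =
      ∑ j, w j • (⟨vWord A [] j, vWord_mem_V hA [] j⟩ : V) := by
    ext k
    simp [vVec_eq_sum_vWord hA hdet]
  induction N with
  | zero => simpa [wordAvg] using hv
  | succ N ih =>
    -- Applying T and adding v prepends one letter to every word; T does not see the constant entry
    -- of its argument.
    have hTv : ∀ (l : List I) (i : I), T ⟨vWord A l i, vWord_mem_V hA l i⟩ +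
        ∑ j, w j • (⟨vWord A [] j, vWord_mem_V hA [] j⟩ : V) =
        ∑ j, w j • (⟨vWord A (i :: l) j, vWord_mem_V hA (i :: l) j⟩ : V) := by
      intro l i
      ext k
      have h1 := (hT ⟨vWord A l i, vWord_mem_V hA l i⟩ k).unique
        (hasSum_bCoeff_mul_vSeq hA w (by
          rw [Complex.norm_real]
          exact (isAllowable_wordProd hA (i :: l)).abs_mobius_F_zero_le_one) _ k)
      simp only [← vImage_add_vWord hA (i :: l)]
      simp [h1, Finset.sum_add_distrib]
    rw [Finset.sum_range_succ']
    simp only [pow_succ', Module.End.mul_apply]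
    -- The vector v is written as the average of a constant, so that it merges with the average over
    -- words.
    rw [← map_sum, ih, pow_zero, Module.End.one_apply, hv, ← wordAvg_sum_cons,
      ← wordAvg_const w hw N (∑ j, w j • (⟨vWord A [] j, vWord_mem_V hA [] j⟩ : V)),
      ← LinearMap.restrictScalars_apply ℝ, map_wordAvg, ← wordAvg_add]
    congr 1
    funext l
    rw [LinearMap.restrictScalars_apply]
    simp only [← hTv, smul_add, Finset.sum_add_distrib, ← Finset.sum_smul, hw, one_smul]
    rw [map_sum]
    exact congrArg (· + _) (Finset.sum_congr rfl fun i _ => LinearMap.map_smul_of_tower T (w i) _)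

theorem sum_pow_operator_apply_zero {A : I → Matrix (Fin 2) (Fin 2) ℝ}
    (hA : ∀ i p q, 0 < A i p q) (hdet : ∀ i, (A i).det ≠ 0) {w : I → ℝ} (hw : ∑ i, w i = 1)
    {T : V →ₗ[ℂ] V} (hT : ∀ (u : V) (k : ℕ),
      HasSum (fun n => (bCoeff A w k n : ℂ) * (u : ℕ → ℂ) n) ((T u : ℕ → ℂ) k)) (N : ℕ) :
    ∑ k ∈ Finset.range (N + 1), ((T ^ k) ⟨vVec A w, vVec_mem_V hA w⟩ : ℕ → ℂ) 0 =
      ((logAvg A w (N + 1) - logAvg A w N : ℝ) : ℂ) := by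
  let L : V →ₗ[ℝ] ℂ := ((LinearMap.proj 0 : (ℕ → ℂ) →ₗ[ℂ] ℂ).comp V.subtype).restrictScalars ℝ
  have h1 := congrArg L (sum_pow_operator_eq_wordAvg hA hdet hw hT N)
  rw [map_sum, map_wordAvg] at h1
  refine h1.trans ?_
  unfold logAvg
  rw [← wordAvg_sum_cons, ← wordAvg_sub]
  refine Eq.trans ?_ (map_wordAvg w Complex.ofRealCLM.toLinearMap N _).symm
  congr 1
  funext l
  rw [map_sum]
  simp [L, vWord, vSeq_zero, mul_sub, Finset.sum_sub_distrib, ← Finset.sum_mul,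
    ← Complex.ofReal_sum, hw, Complex.ofReal_sum (s := Finset.univ) (f := fun x => _ * _)]

end Matrices

/-! ### Geometric contraction and quasi-additivity -/

section Contraction

/-- The permanent of a two by two matrix. -/
def perm (B : Matrix (Fin 2) (Fin 2) ℝ) : ℝ :=
  B 0 0 * B 1 1 + B 0 1 * B 1 0

/-- The determinant is multiplicative, so this makes |det| / perm submultiplicative on products. -/
theorem perm_mul_le {A B : Matrix (Fin 2) (Fin 2) ℝ} (hA : ∀ p q, 0 ≤ A p q)
    (hB : ∀ p q, 0 ≤ B p q) : perm A * perm B ≤ perm (A * B) := by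
  simp only [perm, mul_apply, Fin.sum_univ_two]
  have h1 : 0 ≤ A 0 0 * A 1 0 * (B 0 0 * B 0 1) :=
    mul_nonneg (mul_nonneg (hA _ _) (hA _ _)) (mul_nonneg (hB _ _) (hB _ _))
  have h2 : 0 ≤ A 0 1 * A 1 1 * (B 1 0 * B 1 1) :=
    mul_nonneg (mul_nonneg (hA _ _) (hA _ _)) (mul_nonneg (hB _ _) (hB _ _))
  linarith

theorem perm_le_sq_entrySum {B : Matrix (Fin 2) (Fin 2) ℝ} (hB : ∀ p q, 0 ≤ B p q) :
    perm B ≤ entrySum B ^ 2 := by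
  have h00 := hB 0 0
  have h01 := hB 0 1
  have h10 := hB 1 0
  have h11 := hB 1 1
  rw [perm, entrySum, ← sub_nonneg]
  ring_nf
  positivity

theorem entrySum_mul_eq (A B : Matrix (Fin 2) (Fin 2) ℝ) :
    entrySum (A * B) =
      (A 0 0 + A 1 0) * (B 0 0 + B 0 1) + (A 0 1 + A 1 1) * (B 1 0 + B 1 1) := by
  simp only [entrySum, mul_apply, Fin.sum_univ_two]
  ring

theorem entrySum_mul_le {A B : Matrix (Fin 2) (Fin 2) ℝ} (hA : ∀ p q, 0 ≤ A p q)
    (hB : ∀ p q, 0 ≤ B p q) : entrySum (A * B) ≤ entrySum A * entrySum B := by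
  rw [entrySum_mul_eq, entrySum, entrySum, ← sub_nonneg]
  have h1 := add_nonneg (hA 0 0) (hA 1 0)
  have h2 := add_nonneg (hA 0 1) (hA 1 1)
  have h3 := add_nonneg (hB 0 0) (hB 0 1)
  have h4 := add_nonneg (hB 1 0) (hB 1 1)
  nlinarith [mul_nonneg h1 h4, mul_nonneg h2 h3]

/-- With u the column sums of A and v the row sums of C, the left side is the 2×2 determinant of the
pairings of u and (1,1) with v and (1,1) through B, up to row order; it factors by multiplicativity
of det. -/
theorem entrySum_mul_mul_sub (A B C : Matrix (Fin 2) (Fin 2) ℝ) :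
    entrySum (A * B * C) * entrySum B - entrySum (A * B) * entrySum (B * C) =
      (A 0 0 + A 1 0 - (A 0 1 + A 1 1)) * (C 0 0 + C 0 1 - (C 1 0 + C 1 1)) * B.det := by
  simp only [entrySum, mul_apply, Fin.sum_univ_two, det_fin_two]
  ring

theorem log_sub_log_le {x y m : ℝ} (hm : 0 < m) (hx : m ≤ x) (hy : m ≤ y) :
    Real.log x - Real.log y ≤ |x - y| / m := by
  have hy0 := hm.trans_le hy
  have hx0 := hm.trans_le hx
  rw [← Real.log_div hx0.ne' hy0.ne']
  calc Real.log (x / y) ≤ x / y - 1 := Real.log_le_sub_one_of_pos (div_pos hx0 hy0)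
    _ = (x - y) / y := by field_simp
    _ ≤ |x - y| / y := div_le_div_of_nonneg_right (le_abs_self _) hy0.le
    _ ≤ |x - y| / m := div_le_div_of_nonneg_left (abs_nonneg _) hm hy

theorem abs_log_sub_log_le {x y m : ℝ} (hm : 0 < m) (hx : m ≤ x) (hy : m ≤ y) :
    |Real.log x - Real.log y| ≤ |x - y| / m :=
  abs_sub_le_iff.2 ⟨log_sub_log_le hm hx hy, by
    rw [abs_sub_comm]
    exact log_sub_log_le hm hy hx⟩

theorem abs_sum_mul_le {I : Type*} [Fintype I] {w : I → ℝ} (hw : ∀ i, 0 ≤ w i)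
    (hw1 : ∑ i, w i = 1) {x : I → ℝ} {C : ℝ} (hx : ∀ i, |x i| ≤ C) : |∑ i, w i * x i| ≤ C :=
  -- A weighted mean is an average over one-letter words; the default 0 on the empty word is never
  -- used.
  abs_wordAvg_le hw hw1 1 (φ := fun l => l.head?.elim 0 x) fun l hl => by
    obtain ⟨i, rfl⟩ := List.length_eq_one_iff.1 hl
    exact hx i

variable {I : Type*} {A : I → Matrix (Fin 2) (Fin 2) ℝ} {m M : ℝ} (hm : 0 < m)
  (hA : ∀ i p q, m ≤ A i p q) (hM : ∀ i p q, A i p q ≤ M)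

include hA

theorem two_mul_entrySum_le_mul (i : I) {B : Matrix (Fin 2) (Fin 2) ℝ} (hB : IsAllowable B) :
    2 * m * entrySum B ≤ entrySum (A i * B) := by
  rw [entrySum_mul_eq, entrySum]
  nlinarith [mul_nonneg (sub_nonneg.2 (hA i 0 0)) (hB.2 0).le,
    mul_nonneg (sub_nonneg.2 (hA i 1 0)) (hB.2 0).le,
    mul_nonneg (sub_nonneg.2 (hA i 0 1)) (hB.2 1).le,
    mul_nonneg (sub_nonneg.2 (hA i 1 1)) (hB.2 1).le]

theorem two_mul_entrySum_le_mul' (i : I) {B : Matrix (Fin 2) (Fin 2) ℝ} (hB : IsAllowable B) :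
    2 * m * entrySum B ≤ entrySum (B * A i) := by
  rw [entrySum_mul_eq, entrySum]
  have h1 := add_nonneg (hB.1 0 0) (hB.1 1 0)
  have h2 := add_nonneg (hB.1 0 1) (hB.1 1 1)
  nlinarith [mul_nonneg (sub_nonneg.2 (hA i 0 0)) h1, mul_nonneg (sub_nonneg.2 (hA i 0 1)) h1,
    mul_nonneg (sub_nonneg.2 (hA i 1 0)) h2, mul_nonneg (sub_nonneg.2 (hA i 1 1)) h2]

include hm

theorem entries_pos (i : I) (p q : Fin 2) : 0 < A i p q :=
  hm.trans_le (hA i p q)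

include hM

/-- For one matrix perm - |det| is twice the smaller of the two diagonal products, hence at least
2m², while perm ≤ 2M². -/
theorem abs_det_wordProd_le (l : List I) :
    |(wordProd A l).det| ≤ (1 - m ^ 2 / M ^ 2) ^ l.length * perm (wordProd A l) := by
  induction l with
  | nil => simp [wordProd, perm]
  | cons i l ih =>
    have hpos := entries_pos hm hA
    have hM0 : 0 < M := (hpos i 0 0).trans_le (hM i 0 0)
    have hmM : m ≤ M := (hA i 0 0).trans (hM i 0 0)
    have hρ : 0 ≤ 1 - m ^ 2 / M ^ 2 := by
      rw [sub_nonneg, div_le_one (by positivity)]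
      gcongr
    have hprod : ∀ p q p' q', m ^ 2 ≤ A i p q * A i p' q' := fun p q p' q' => by
      rw [sq]
      exact mul_le_mul (hA _ _ _) (hA _ _ _) hm.le (hpos _ _ _).le
    have hprod' : ∀ p q p' q', A i p q * A i p' q' * (m ^ 2 / M ^ 2) ≤ m ^ 2 :=
      fun p q p' q' => by
        rw [mul_div_assoc', div_le_iff₀ (by positivity), mul_comm]
        gcongr
        rw [sq]
        exact mul_le_mul (hM _ _ _) (hM _ _ _) (hpos _ _ _).le hM0.le
    have hdet : |(A i).det| ≤ (1 - m ^ 2 / M ^ 2) * perm (A i) := by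
      rw [det_fin_two, perm, abs_le]
      constructor <;>
      linarith [hprod 0 0 1 1, hprod 0 1 1 0, hprod' 0 0 1 1, hprod' 0 1 1 0]
    rw [wordProd_cons, det_mul, abs_mul, List.length_cons, pow_succ']
    calc |(A i).det| * |(wordProd A l).det|
        ≤ ((1 - m ^ 2 / M ^ 2) * perm (A i)) *
          ((1 - m ^ 2 / M ^ 2) ^ l.length * perm (wordProd A l)) :=
          mul_le_mul hdet ih (abs_nonneg _) ((abs_nonneg _).trans hdet)
      _ = (1 - m ^ 2 / M ^ 2) * (1 - m ^ 2 / M ^ 2) ^ l.length *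
          (perm (A i) * perm (wordProd A l)) := by ring
      _ ≤ _ := mul_le_mul_of_nonneg_left
          (perm_mul_le (fun p q => (hpos i p q).le) (isAllowable_wordProd hpos l).1)
          (mul_nonneg hρ (pow_nonneg hρ _))

/-- Both products under the logarithms are at least (2m)²|B|² and differ by at most (2M)²|det B|,
with |det B| ≤ perm B · ρ^length ≤ |B|² ρ^length, where ρ = 1 - m²/M². -/
theorem abs_log_cross_ratio_le (i j : I) (l : List I) :
    |Real.log (entrySum (A i * wordProd A l * A j)) + Real.log (entrySum (wordProd A l)) -
      (Real.log (entrySum (A i * wordProd A l)) + Real.log (entrySum (wordProd A l * A j)))| ≤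
      M ^ 2 / m ^ 2 * (1 - m ^ 2 / M ^ 2) ^ l.length := by
  have hpos := entries_pos hm hA
  have hB := isAllowable_wordProd hpos l
  have hAi := isAllowable_of_pos (hpos i)
  have hAj := isAllowable_of_pos (hpos j)
  have hs := hB.entrySum_pos
  have hiB := two_mul_entrySum_le_mul hA i hB
  have hBj := two_mul_entrySum_le_mul' hA j hB
  have hiBj := two_mul_entrySum_le_mul' hA j (hAi.mul hB)
  have hdet := abs_det_wordProd_le hm hA hM l
  have hperm := perm_le_sq_entrySum hB.1
  have hM0 : 0 < M := (hpos i 0 0).trans_le (hM i 0 0)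
  have hmM : m ≤ M := (hA i 0 0).trans (hM i 0 0)
  have hρ : 0 ≤ 1 - m ^ 2 / M ^ 2 := by
    rw [sub_nonneg, div_le_one (by positivity)]
    gcongr
  rw [← Real.log_mul ((hAi.mul hB).mul hAj).entrySum_pos.ne' hs.ne',
    ← Real.log_mul (hAi.mul hB).entrySum_pos.ne' (hB.mul hAj).entrySum_pos.ne']
  refine (abs_log_sub_log_le (m := (2 * m) ^ 2 * entrySum (wordProd A l) ^ 2) (by positivity)
    ?_ ?_).trans ?_
  · calc (2 * m) ^ 2 * entrySum (wordProd A l) ^ 2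
        = 2 * m * (2 * m * entrySum (wordProd A l)) * entrySum (wordProd A l) := by ring
      _ ≤ 2 * m * entrySum (A i * wordProd A l) * entrySum (wordProd A l) := by gcongr
      _ ≤ _ := by gcongr
  · calc (2 * m) ^ 2 * entrySum (wordProd A l) ^ 2
        = (2 * m * entrySum (wordProd A l)) * (2 * m * entrySum (wordProd A l)) := by ring
      _ ≤ _ := mul_le_mul hiB hBj (by positivity) (hAi.mul hB).entrySum_pos.le
  · rw [entrySum_mul_mul_sub, abs_mul, abs_mul, div_le_iff₀ (by positivity)]
    have h1 : |A i 0 0 + A i 1 0 - (A i 0 1 + A i 1 1)| ≤ 2 * M := by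
      rw [abs_le]
      constructor <;> linarith [hpos i 0 0, hpos i 0 1, hpos i 1 0, hpos i 1 1, hM i 0 0,
        hM i 0 1, hM i 1 0, hM i 1 1]
    have h2 : |A j 0 0 + A j 0 1 - (A j 1 0 + A j 1 1)| ≤ 2 * M := by
      rw [abs_le]
      constructor <;> linarith [hpos j 0 0, hpos j 0 1, hpos j 1 0, hpos j 1 1, hM j 0 0,
        hM j 0 1, hM j 1 0, hM j 1 1]
    calc |A i 0 0 + A i 1 0 - (A i 0 1 + A i 1 1)| * |A j 0 0 + A j 0 1 - (A j 1 0 + A j 1 1)| *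
          |(wordProd A l).det|
        ≤ 2 * M * (2 * M) *
          ((1 - m ^ 2 / M ^ 2) ^ l.length * entrySum (wordProd A l) ^ 2) := by
          gcongr
          exact hdet.trans (by gcongr)
      _ = _ := by field_simp

/-- The row sums of a product of the matrices are comparable. -/
theorem mul_entrySum_wordProd_le (l : List I) (hl : m ≤ M) (p : Fin 2) :
    m / (2 * M) * entrySum (wordProd A l) ≤ wordProd A l p 0 + wordProd A l p 1 := by
  have hM0 : 0 < M := hm.trans_le hl
  rw [div_mul_eq_mul_div, div_le_iff₀ (by positivity)]
  cases l with
  -- The identity has row sums 1 and entry sum 2, so the empty word is where m ≤ M enters directly.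
  | nil => fin_cases p <;> norm_num [wordProd, entrySum] <;> linarith
  | cons i l =>
    have hB := isAllowable_wordProd (entries_pos hm hA) l
    have hle : entrySum (A i * wordProd A l) ≤ 2 * M * entrySum (wordProd A l) := by
      rw [entrySum_mul_eq, entrySum]
      nlinarith [mul_nonneg (sub_nonneg.2 (hM i 0 0)) (hB.2 0).le,
        mul_nonneg (sub_nonneg.2 (hM i 1 0)) (hB.2 0).le,
        mul_nonneg (sub_nonneg.2 (hM i 0 1)) (hB.2 1).le,
        mul_nonneg (sub_nonneg.2 (hM i 1 1)) (hB.2 1).le]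
    have hge : m * entrySum (wordProd A l) ≤
        (A i * wordProd A l) p 0 + (A i * wordProd A l) p 1 := by
      simp only [entrySum, mul_apply, Fin.sum_univ_two]
      nlinarith [mul_nonneg (sub_nonneg.2 (hA i p 0)) (hB.2 0).le,
        mul_nonneg (sub_nonneg.2 (hA i p 1)) (hB.2 1).le]
    rw [wordProd_cons]
    calc m * entrySum (A i * wordProd A l) ≤ m * (2 * M * entrySum (wordProd A l)) := by gcongr
      _ = m * entrySum (wordProd A l) * (2 * M) := by ring
      _ ≤ _ := by gcongr

/-- Submultiplicativity of the entry sum gives one side. For the other, both row sums of the right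
factor are at least m/(2M) times its entry sum. -/
theorem abs_log_entrySum_append_le (hmM : m ≤ M) (l l' : List I) :
    |Real.log (entrySum (wordProd A (l ++ l'))) -
      (Real.log (entrySum (wordProd A l)) + Real.log (entrySum (wordProd A l')))| ≤
      -Real.log (m / (2 * M)) := by
  have hM0 : 0 < M := hm.trans_le hmM
  have hB := isAllowable_wordProd (entries_pos hm hA) l
  have hB' := isAllowable_wordProd (entries_pos hm hA) l'
  have hκ : 0 < m / (2 * M) := by positivity
  have hs := hB.entrySum_pos
  have hs' := hB'.entrySum_pos
  have hss := (hB.mul hB').entrySum_pos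
  have hκ1 : Real.log (m / (2 * M)) ≤ 0 :=
    Real.log_nonpos hκ.le ((div_le_one (by positivity)).2 (by linarith))
  have hup := Real.log_le_log hss (entrySum_mul_le hB.1 hB'.1)
  have hlow : m / (2 * M) * (entrySum (wordProd A l) * entrySum (wordProd A l')) ≤
      entrySum (wordProd A l * wordProd A l') := by
    rw [entrySum_mul_eq]
    have h0 := mul_le_mul_of_nonneg_left (mul_entrySum_wordProd_le hm hA hM l' hmM 0)
      (add_nonneg (hB.1 0 0) (hB.1 1 0))
    have h1 := mul_le_mul_of_nonneg_left (mul_entrySum_wordProd_le hm hA hM l' hmM 1)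
      (add_nonneg (hB.1 0 1) (hB.1 1 1))
    rw [entrySum.eq_def (wordProd A l)]
    linarith
  have hlow := Real.log_le_log (by positivity) hlow
  rw [Real.log_mul hκ.ne' (by positivity), Real.log_mul hs.ne' hs'.ne'] at hlow
  rw [Real.log_mul hs.ne' hs'.ne'] at hup
  rw [wordProd_append, abs_le]
  constructor <;> linarith

variable [Fintype I] {w : I → ℝ} (hw : ∀ i, 0 ≤ w i) (hw1 : ∑ i, w i = 1)

include hw hw1

theorem abs_logAvg_second_difference_le (n : ℕ) :
    |logAvg A w (n + 2) - logAvg A w (n + 1) - (logAvg A w (n + 1) - logAvg A w n)| ≤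
      M ^ 2 / m ^ 2 * (1 - m ^ 2 / M ^ 2) ^ n := by
  have h : logAvg A w (n + 2) - logAvg A w (n + 1) - (logAvg A w (n + 1) - logAvg A w n) =
      wordAvg w n fun l => ∑ i, w i * ∑ j, w j *
        (Real.log (entrySum (A i * wordProd A l * A j)) + Real.log (entrySum (wordProd A l)) -
          (Real.log (entrySum (A i * wordProd A l)) +
            Real.log (entrySum (wordProd A l * A j)))) := by
    have h1 : logAvg A w (n + 2) = wordAvg w n fun l => ∑ i, w i * ∑ j, w j *
        Real.log (entrySum (A i * wordProd A l * A j)) := by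
      rw [logAvg, ← wordAvg_sum_cons, ← wordAvg_sum_concat]
      congr 1
      funext l
      simp only [smul_eq_mul, Finset.mul_sum]
      rw [Finset.sum_comm]
      refine Finset.sum_congr rfl fun i _ => Finset.sum_congr rfl fun j _ => ?_
      rw [wordProd_cons, wordProd_append, wordProd_singleton, mul_assoc (A i)]
      ring
    have h2 : logAvg A w (n + 1) = wordAvg w n fun l => ∑ i, w i *
        Real.log (entrySum (A i * wordProd A l)) := by
      rw [logAvg, ← wordAvg_sum_cons]
      simp only [wordProd_cons, smul_eq_mul]
    -- The same mean is expanded at both ends, left in `h2` and right here, so that the four terms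
    -- form a cross ratio around one word.
    have h3 : logAvg A w (n + 1) = wordAvg w n fun l => ∑ i, w i *
        Real.log (entrySum (wordProd A l * A i)) := by
      rw [logAvg, ← wordAvg_sum_concat]
      simp only [wordProd_append, wordProd_singleton, smul_eq_mul]
    rw [h1]
    nth_rw 1 [h2]
    rw [h3, logAvg, ← wordAvg_sub, ← wordAvg_sub, ← wordAvg_sub]
    congr 1
    funext l
    simp only [mul_sub, mul_add, Finset.sum_sub_distrib, Finset.sum_add_distrib,
      ← Finset.sum_mul, hw1, one_mul]
    ring
  rw [h]
  refine abs_wordAvg_le hw hw1 n fun l hl => abs_sum_mul_le hw hw1 fun i =>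
    abs_sum_mul_le hw hw1 fun j => ?_
  rw [← hl]
  exact abs_log_cross_ratio_le hm hA hM i j l

theorem exists_tendsto_logAvg_sub (hmM : m ≤ M) :
    ∃ S : ℝ, Tendsto (fun n => logAvg A w (n + 1) - logAvg A w n) atTop (𝓝 S) := by
  have hM0 : 0 < M := hm.trans_le hmM
  refine cauchySeq_tendsto_of_complete (cauchySeq_of_le_geometric (1 - m ^ 2 / M ^ 2)
    (M ^ 2 / m ^ 2) (sub_lt_self _ (by positivity)) fun n => ?_)
  rw [dist_comm, Real.dist_eq]
  exact abs_logAvg_second_difference_le hm hA hM hw hw1 n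

end Contraction

theorem tendsto_div_of_tendsto_sub {u : ℕ → ℝ} {S : ℝ}
    (h : Tendsto (fun n => u (n + 1) - u n) atTop (𝓝 S)) :
    Tendsto (fun n : ℕ => u n / n) atTop (𝓝 S) := by
  have h1 := h.cesaro
  have h2 := (tendsto_const_div_atTop_nhds_zero_nat (u 0)).add h1
  rw [zero_add] at h2
  refine h2.congr fun n => ?_
  rw [Finset.sum_range_sub]
  ring

/-! ### Linear growth of quasi-additive functions (the newest letter stands on the left, as in the
matrix products) -/

section Words

variable {I : Type*}

/-- The word `f (n - 1), …, f 1, f 0`. -/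
def seqWord (f : ℕ → I) : ℕ → List I
  | 0 => []
  | n + 1 => f n :: seqWord f n

theorem seqWord_add (f : ℕ → I) (m n : ℕ) :
    seqWord f (m + n) = seqWord (fun k => f (m + k)) n ++ seqWord f m := by
  induction n with
  | zero => rfl
  | succ n ih => rw [← add_assoc, seqWord, seqWord, ih, List.cons_append]

theorem length_seqWord (f : ℕ → I) (n : ℕ) : (seqWord f n).length = n := by
  induction n with
  | zero => rfl
  | succ n ih => rw [seqWord, List.length_cons, ih]

theorem seqWord_eq_reverse_ofFn (f : ℕ → I) (n : ℕ) :
    seqWord f n = (List.ofFn fun k : Fin n => f k).reverse := by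
  induction n with
  | zero => rfl
  | succ n ih =>
    rw [seqWord, ih, List.ofFn_succ', List.concat_eq_append, List.reverse_append]
    rfl

variable {φ : List I → ℝ} {C D : ℝ} (hφ : ∀ l l', |φ (l ++ l') - (φ l + φ l')| ≤ C)

include hφ

theorem abs_apply_nil_le : |φ []| ≤ C := by
  have h := hφ [] []
  rwa [List.append_nil, sub_add_cancel_left, abs_neg] at h

theorem abs_sub_sum_blocks_le (f : ℕ → I) (K L : ℕ) :
    |φ (seqWord f (K * L)) - ∑ j ∈ Finset.range K, φ (seqWord (fun k => f (j * L + k)) L)| ≤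
      C * (K + 1) := by
  induction K with
  | zero => simpa [seqWord] using abs_apply_nil_le hφ
  | succ K ih =>
    rw [Nat.succ_mul, seqWord_add, Finset.sum_range_succ]
    have h := hφ (seqWord (fun k => f (K * L + k)) L) (seqWord f (K * L))
    rw [abs_le] at h ih ⊢
    push_cast
    constructor <;> linarith [h.1, h.2, ih.1, ih.2]

theorem abs_apply_le_length (hD : ∀ i, |φ [i]| ≤ D) (l : List I) :
    |φ l| ≤ (C + D) * l.length + C := by
  induction l with
  | nil => simpa using abs_apply_nil_le hφ
  | cons i l ih =>
    have h := hφ [i] l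
    have hi := hD i
    rw [List.singleton_append] at h
    rw [List.length_cons]
    push_cast
    rw [abs_le] at h ih hi ⊢
    constructor <;> linarith [h.1, h.2, ih.1, ih.2, hi.1, hi.2]

/-- A quasi-additive function of the initial words of a sequence grows linearly if it does so in the
mean over blocks. -/
theorem tendsto_apply_seqWord_div (hD0 : 0 ≤ D) (hD : ∀ i, |φ [i]| ≤ D) {ℓ : ℕ → ℝ} {S : ℝ}
    (hℓ : Tendsto (fun L : ℕ => ℓ L / L) atTop (𝓝 S)) (f : ℕ → I)
    (hf : ∀ L : ℕ, 1 ≤ L → Tendsto (fun K : ℕ =>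
      (∑ j ∈ Finset.range K, φ (seqWord (fun k => f (j * L + k)) L)) / K) atTop (𝓝 (ℓ L))) :
    Tendsto (fun n : ℕ => φ (seqWord f n) / n) atTop (𝓝 S) := by
  have hC : 0 ≤ C := (abs_nonneg _).trans (abs_apply_nil_le hφ)
  rw [Metric.tendsto_nhds]
  intro ε hε
  -- Block length with two errors below ε/4: the block mean against S, and the additivity defect C
  -- paid once per block.
  obtain ⟨L, hL1, hLS, hLC⟩ : ∃ L : ℕ, 1 ≤ L ∧ |ℓ L / L - S| < ε / 4 ∧ C / L < ε / 4 := by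
    have h1 := Metric.tendsto_nhds.1 hℓ (ε / 4) (by positivity)
    have h2 := (tendsto_const_div_atTop_nhds_zero_nat C).eventually_lt_const
      (show 0 < ε / 4 by positivity)
    obtain ⟨L, h⟩ := ((eventually_ge_atTop 1).and (h1.and h2)).exists
    exact ⟨L, h⟩
  have hL0 : (0 : ℝ) < L := by exact_mod_cast hL1
  set Z : ℕ → ℝ := fun K => ∑ j ∈ Finset.range K, φ (seqWord (fun k => f (j * L + k)) L) with hZ
  have hdiv : Tendsto (fun n : ℕ => n / L) atTop atTop :=
    tendsto_atTop.2 fun b => (eventually_ge_atTop (b * L)).mono fun n hn =>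
      (Nat.le_div_iff_mul_le hL1).2 hn
  have hfrac : Tendsto (fun n : ℕ => ((n / L : ℕ) : ℝ) / n) atTop (𝓝 (1 / L)) := by
    have h := (tendsto_nat_floor_mul_div_atTop (R := ℝ) (a := 1 / L) (by positivity)).comp
      tendsto_natCast_atTop_atTop
    refine h.congr fun n => ?_
    simp only [Function.comp_apply]
    rw [one_div_mul_eq_div, Nat.floor_div_eq_div]
  have hmain : Tendsto (fun n : ℕ => Z (n / L) / n) atTop (𝓝 (ℓ L / L)) := by
    have h := ((hf L hL1).comp hdiv).mul hfrac
    rw [mul_one_div] at h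
    refine h.congr' ?_
    filter_upwards [hdiv.eventually_ge_atTop 1] with n hn
    have : ((n / L : ℕ) : ℝ) ≠ 0 := Nat.cast_ne_zero.2 (by omega)
    simp only [Function.comp_apply]
    rw [div_mul_div_cancel₀ this]
  -- The error not growing with n: C each from splitting off the remainder, from the empty product
  -- in the block sum and from the length bound, and (C + D)L for the at most L remaining letters.
  set E : ℝ := 3 * C + (C + D) * L with hE
  have hE0 := (tendsto_const_div_atTop_nhds_zero_nat E).eventually_lt_const
    (show 0 < ε / 4 by positivity)
  filter_upwards [Metric.tendsto_nhds.1 hmain (ε / 4) (by positivity), hE0,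
    eventually_ge_atTop 1] with n h1 h2 hn
  have hn0 : (0 : ℝ) < n := by exact_mod_cast hn
  have hbound : |φ (seqWord f n) - Z (n / L)| ≤ C * (n / L : ℕ) + E := by
    have e1 := hφ (seqWord (fun k => f (n / L * L + k)) (n % L)) (seqWord f (n / L * L))
    rw [← seqWord_add, Nat.div_add_mod'] at e1
    have e2 := abs_sub_sum_blocks_le hφ f (n / L) L
    have e3 := abs_apply_le_length hφ hD (seqWord (fun k => f (n / L * L + k)) (n % L))
    rw [length_seqWord] at e3
    have e4 : (C + D) * (n % L : ℕ) ≤ (C + D) * L := by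
      gcongr
      exact (Nat.mod_lt n hL1).le
    rw [abs_le] at e1 e2 e3 ⊢
    constructor <;> linarith [e1.1, e1.2, e2.1, e2.2, e3.1, e3.2]
  have hquot : |φ (seqWord f n) / n - Z (n / L) / n| ≤ C / L + E / n := by
    rw [← sub_div, abs_div, abs_of_pos hn0, div_le_iff₀ hn0, add_mul, div_mul_cancel₀ _ hn0.ne']
    refine hbound.trans ?_
    have : ((n / L : ℕ) : ℝ) ≤ n / L := Nat.cast_div_le
    have := mul_le_mul_of_nonneg_left this hC
    rw [div_mul_eq_mul_div, mul_div_assoc]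
    linarith
  rw [Real.dist_eq] at h1 ⊢
  rw [abs_lt] at h1 hLS ⊢
  rw [abs_le] at hquot
  constructor <;> linarith [hquot.1, hquot.2, h1.1, h1.2, hLS.1, hLS.2]

end Words

/-! ### Word averages as expectations, and the strong law on blocks -/

section Probability

variable {J : Type*} [Fintype J] [MeasurableSpace J] [MeasurableSingletonClass J]
  {Ω : Type*} [MeasurableSpace Ω] {μ : Measure Ω} {X : ℕ → Ω → J}
  (hX : ∀ n, Measurable (X n)) (hind : iIndepFun X μ) {w : J → ℝ}
  (hlaw : ∀ n i, μ.real (X n ⁻¹' {i}) = w i)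

include hX hind hlaw

/-- Conditioning on the leftmost letter X n, which is independent of the earlier ones, reproduces
the recursion of `wordAvg`. -/
theorem integral_seqWord (n : ℕ) (φ : List J → ℝ) :
    ∫ ω, φ (seqWord (fun k => X k ω) n) ∂μ = wordAvg w n φ := by
  classical
  have := hind.isProbabilityMeasure
  induction n generalizing φ with
  | zero => simp [seqWord, wordAvg]
  | succ n ih =>
    have hU : Measurable fun ω (k : Fin n) => X k ω := measurable_pi_lambda _ fun k => hX k
    have hindep : IndepFun (X n) (fun ω (k : Fin n) => X k ω) μ := by
      have h1 : Measurable fun t : ({n} : Finset ℕ) → J => t ⟨n, Finset.mem_singleton_self n⟩ :=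
        measurable_pi_apply _
      have h2 : Measurable fun (t : Finset.range n → J) (k : Fin n) =>
          t ⟨k, Finset.mem_range.2 k.2⟩ :=
        measurable_pi_lambda _ fun k => measurable_pi_apply _
      exact (hind.indepFun_finset {n} (Finset.range n) (by simp) hX).comp h1 h2
    have hsplit : ∀ ω, φ (seqWord (fun k => X k ω) (n + 1)) =
        ∑ i, (if X n ω = i then 1 else 0) *
          φ (i :: (List.ofFn fun k : Fin n => X k ω).reverse) := by
      intro ω
      simp [seqWord, seqWord_eq_reverse_ofFn]
    simp only [hsplit]
    rw [integral_finsetSum, wordAvg]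
    · refine Finset.sum_congr rfl fun i _ => ?_
      rw [hindep.integral_fun_comp_mul_comp (f := fun x : J => if x = i then (1 : ℝ) else 0)
        (g := fun t : Fin n → J => φ (i :: (List.ofFn t).reverse)) (hX n).aemeasurable
        hU.aemeasurable (measurable_of_finite _).aestronglyMeasurable
        (measurable_of_finite _).aestronglyMeasurable, smul_eq_mul, ← ih, ← hlaw n i,
        ← integral_indicator_one (hX n (measurableSet_singleton i))]
      congr 1
      simp only [seqWord_eq_reverse_ofFn]
    · intro i _
      exact (Integrable.of_finite (μ := μ.map fun ω => (X n ω, fun k : Fin n => X k ω))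
        (f := fun p => (if p.1 = i then 1 else 0) * φ (i :: (List.ofFn p.2).reverse))).comp_measurable
        ((hX n).prodMk hU)

/-- The law of large numbers for a function of the consecutive blocks of an i.i.d. sequence. -/
theorem ae_tendsto_block_average (L : ℕ) (φ : List J → ℝ) :
    ∀ᵐ ω ∂μ, Tendsto (fun K : ℕ =>
      (∑ j ∈ Finset.range K, φ (seqWord (fun k => X (j * L + k) ω) L)) / K) atTop
      (𝓝 (wordAvg w L φ)) := by
  have := hind.isProbabilityMeasure
  let U : ℕ → Ω → Fin L → J := fun j ω k => X (j * L + k) ω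
  let h : (Fin L → J) → ℝ := fun t => φ (List.ofFn t).reverse
  have hU : ∀ j, Measurable (U j) := fun j => measurable_pi_lambda _ fun k => hX _
  have hh : Measurable h := measurable_of_finite _
  have hY : ∀ j ω, φ (seqWord (fun k => X (j * L + k) ω) L) = h (U j ω) := fun j ω => by
    rw [seqWord_eq_reverse_ofFn]
  -- Pairwise independence suffices for the strong law; the blocks use disjoint index intervals.
  have hpair : Pairwise (Function.onFun (IndepFun · · μ) fun j => h ∘ U j) := by
    intro i j hij
    have hdisj : Disjoint (Finset.Ico (i * L) (i * L + L)) (Finset.Ico (j * L) (j * L + L)) := by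
      rw [Finset.disjoint_left]
      intro n hi hj
      rw [Finset.mem_Ico] at hi hj
      apply hij
      rw [← Nat.div_eq_of_lt_le hi.1 (by rw [Nat.succ_mul]; exact hi.2),
        ← Nat.div_eq_of_lt_le hj.1 (by rw [Nat.succ_mul]; exact hj.2)]
    have hmem : ∀ (i : ℕ) (k : Fin L), i * L + k ∈ Finset.Ico (i * L) (i * L + L) :=
      fun i k => Finset.mem_Ico.2 ⟨by omega, by omega⟩
    exact (hind.indepFun_finset _ _ hdisj hX).comp
      (φ := fun t => h fun k => t ⟨i * L + k, hmem i k⟩)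
      (ψ := fun t => h fun k => t ⟨j * L + k, hmem j k⟩)
      (hh.comp (measurable_pi_lambda _ fun k => measurable_pi_apply _))
      (hh.comp (measurable_pi_lambda _ fun k => measurable_pi_apply _))
  have hsingle : ∀ a b, IdentDistrib (X a) (X b) μ μ := fun a b =>
    { aemeasurable_fst := (hX a).aemeasurable
      aemeasurable_snd := (hX b).aemeasurable
      map_eq := by
        refine Measure.ext_of_singleton fun i => ?_
        rw [Measure.map_apply (hX a) (measurableSet_singleton i),
          Measure.map_apply (hX b) (measurableSet_singleton i), ← measureReal_eq_measureReal_iff,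
          hlaw, hlaw] }
  have hident : ∀ j, IdentDistrib (h ∘ U j) (h ∘ U 0) μ μ := fun j =>
    (IdentDistrib.pi (fun k : Fin L => hsingle (j * L + k) (0 * L + k))
      (hind.precomp fun a b hab => Fin.ext (Nat.add_left_cancel hab))
      (hind.precomp fun a b hab => Fin.ext (Nat.add_left_cancel hab))).comp hh
  have hint : Integrable (h ∘ U 0) μ :=
    (Integrable.of_finite (μ := μ.map (U 0)) (f := h)).comp_measurable (hU 0)
  have hlim := strong_law_ae_real (fun j => h ∘ U j) hint hpair hident
  have hmean : ∫ ω, (h ∘ U 0) ω ∂μ = wordAvg w L φ := by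
    rw [← integral_seqWord hX hind hlaw]
    refine integral_congr_ae (Eventually.of_forall fun ω => ?_)
    have := hY 0 ω
    simp only [zero_mul, zero_add] at this
    exact this.symm
  rw [hmean] at hlim
  filter_upwards [hlim] with ω hω
  simpa only [hY, Function.comp_apply] using hω

end Probability

/-! ### Words of pairs as words of double length -/

section Pairs

variable {J : Type*}

/-- The concatenation of a word of pairs. -/
def flattenPairs (l : List (J × J)) : List J :=
  l.flatMap fun p => [p.1, p.2]

theorem flattenPairs_seqWord (g : ℕ → J) (n : ℕ) :
    flattenPairs (seqWord (fun t => (g (2 * t + 1), g (2 * t))) n) = seqWord g (2 * n) := by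
  induction n with
  | zero => rfl
  | succ n ih =>
    rw [Nat.mul_succ, seqWord, seqWord, seqWord, ← ih]
    rfl

theorem wordAvg_flattenPairs [Fintype J] {w : J → ℝ} {W : J × J → ℝ}
    (hW : ∀ i j, W (i, j) = w i * w j) (n : ℕ) (φ : List J → ℝ) :
    (wordAvg W n fun l => φ (flattenPairs l)) = wordAvg w (2 * n) φ := by
  induction n generalizing φ with
  | zero => rfl
  | succ n ih =>
    simp only [wordAvg, Fintype.sum_prod_type, hW, Nat.mul_succ, Finset.smul_sum, smul_smul]
    refine Finset.sum_congr rfl fun i _ => Finset.sum_congr rfl fun j _ => ?_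
    rw [← ih]
    rfl

end Pairs

theorem exists_entries_bounds {I : Type*} [Finite I] [Nonempty I]
    {A : I → Matrix (Fin 2) (Fin 2) ℝ} (hA : ∀ i p q, 0 < A i p q) :
    ∃ m M : ℝ, 0 < m ∧ m ≤ M ∧ (∀ i p q, m ≤ A i p q) ∧ ∀ i p q, A i p q ≤ M := by
  obtain ⟨x, hx⟩ := Finite.exists_min fun t : I × Fin 2 × Fin 2 => A t.1 t.2.1 t.2.2
  obtain ⟨y, hy⟩ := Finite.exists_max fun t : I × Fin 2 × Fin 2 => A t.1 t.2.1 t.2.2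
  exact ⟨_, _, hA x.1 x.2.1 x.2.2, hx y, fun i p q => hx (i, p, q), fun i p q => hy (i, p, q)⟩

/-! ### The recurrence as a product of pair matrices -/

section Recurrence

variable {J : Type*} {a b : J → ℝ} {A : J × J → Matrix (Fin 2) (Fin 2) ℝ}
  (hA : ∀ i j, A (i, j) = stepMatrix (a i) (b i) * stepMatrix (a j) (b j))

include hA

theorem stepMatrix_mul_pos (ha : ∀ i, 0 < a i) (hb : ∀ i, 0 < b i) (i j : J) (p q : Fin 2) :
    0 < A (i, j) p q := by
  have hai := ha i
  have haj := ha j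
  have hbi := hb i
  have hbj := hb j
  rw [hA, mul_apply, Fin.sum_univ_two]
  fin_cases p <;> fin_cases q <;> simp [stepMatrix] <;> positivity

theorem det_stepMatrix_mul_ne_zero (hb : ∀ i, 0 < b i) (x : J × J) : (A x).det ≠ 0 := by
  rw [show x = (x.1, x.2) from rfl, hA, det_mul, det_fin_two, det_fin_two]
  simp [stepMatrix, (hb _).ne']

theorem wordProd_eq_flattenPairs (l : List (J × J)) :
    wordProd A l = wordProd (fun i => stepMatrix (a i) (b i)) (flattenPairs l) := by
  induction l with
  | nil => rfl
  | cons x l ih =>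
    rw [wordProd_cons, ih, show x = (x.1, x.2) from rfl, hA,
      show flattenPairs ((x.1, x.2) :: l) = x.1 :: x.2 :: flattenPairs l from rfl, wordProd_cons,
      wordProd_cons, Matrix.mul_assoc]

/-- The step matrix sends (x_{n-1}, x_n) to (x_n, x_{n+1}), and the start is (x_0, x_1) = (1, 1).
The first letter used has index 2, and the later letter of each pair multiplies on the left. -/
theorem rowSum_wordProd_seqWord (f : ℕ → J) (t : ℕ) :
    let B := wordProd A (seqWord (fun t => (f (2 * t + 3), f (2 * t + 2))) t)
    B 0 0 + B 0 1 = recSeq a b f (2 * t) ∧ B 1 0 + B 1 1 = recSeq a b f (2 * t + 1) := by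
  induction t with
  | zero => simp [seqWord, wordProd, recSeq]
  | succ t ih =>
    obtain ⟨h0, h1⟩ := ih
    have e2 : recSeq a b f (2 * t + 2) =
        a (f (2 * t + 2)) * recSeq a b f (2 * t + 1) + b (f (2 * t + 2)) * recSeq a b f (2 * t) :=
      rfl
    have e3 : recSeq a b f (2 * t + 3) =
        a (f (2 * t + 3)) * recSeq a b f (2 * t + 2) +
          b (f (2 * t + 3)) * recSeq a b f (2 * t + 1) :=
      rfl
    simp only [Nat.mul_succ, seqWord, wordProd_cons, hA]
    rw [e3, e2, ← h0, ← h1]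
    simp only [stepMatrix, mul_apply, Fin.sum_univ_two, of_apply, cons_val', cons_val_zero,
      cons_val_one, cons_val_fin_one]
    constructor <;> ring

end Recurrence

theorem tendsto_rpow_of_abs_log_sub_le {x u : ℕ → ℝ} {S C : ℝ} (hx : ∀ n, 0 < x n)
    (hu : Tendsto (fun n : ℕ => u n / n) atTop (𝓝 S))
    (hxu : ∀ n, |Real.log (x n) - u (n / 2)| ≤ C) :
    Tendsto (fun n : ℕ => x n ^ (1 / (n : ℝ))) atTop (𝓝 (Real.exp (1 / 2 * S))) := by
  have hdiv : Tendsto (fun n : ℕ => n / 2) atTop atTop :=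
    tendsto_atTop.2 fun b => (eventually_ge_atTop (b * 2)).mono fun n hn =>
      (Nat.le_div_iff_mul_le two_pos).2 hn
  have hfrac : Tendsto (fun n : ℕ => ((n / 2 : ℕ) : ℝ) / n) atTop (𝓝 (1 / 2)) := by
    have h := (tendsto_nat_floor_mul_div_atTop (R := ℝ) (a := 1 / 2) (by positivity)).comp
      tendsto_natCast_atTop_atTop
    refine h.congr fun n => ?_
    simp only [Function.comp_apply]
    rw [one_div_mul_eq_div, Nat.floor_div_ofNat, Nat.floor_natCast]
  have hmain : Tendsto (fun n : ℕ => u (n / 2) / n) atTop (𝓝 (1 / 2 * S)) := by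
    rw [mul_comm]
    refine ((hu.comp hdiv).mul hfrac).congr' ?_
    filter_upwards [hdiv.eventually_ge_atTop 1] with n hn
    have : ((n / 2 : ℕ) : ℝ) ≠ 0 := Nat.cast_ne_zero.2 (by omega)
    simp only [Function.comp_apply]
    rw [div_mul_div_cancel₀ this]
  have herr : Tendsto (fun n : ℕ => (Real.log (x n) - u (n / 2)) / n) atTop (𝓝 0) := by
    refine squeeze_zero_norm (fun n => ?_) (tendsto_const_div_atTop_nhds_zero_nat C)
    rw [norm_div, Real.norm_eq_abs, Real.norm_natCast]
    exact div_le_div_of_nonneg_right (hxu n) n.cast_nonneg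
  have hlog := herr.add hmain
  rw [zero_add] at hlog
  refine ((Real.continuous_exp.tendsto _).comp hlog).congr fun n => ?_
  simp only [Function.comp_apply]
  rw [← add_div, sub_add_cancel, Real.rpow_def_of_pos (hx n), mul_one_div]

theorem recSeq_pos {J : Type*} {a b : J → ℝ} (ha : ∀ i, 0 < a i) (hb : ∀ i, 0 < b i)
    (f : ℕ → J) (n : ℕ) : 0 < recSeq a b f n := by
  induction n using Nat.twoStepInduction with
  | zero => exact one_pos
  | one => exact one_pos
  | more n h0 h1 =>
    rw [recSeq]
    exact add_pos (mul_pos (ha _) h1) (mul_pos (hb _) h0)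

end ThreeTerm

/-! ### Assembly of the theorem -/

open ThreeTerm in
theorem mainTheorem6 {m : ℕ} (a b w : Fin m → ℝ)
    (ha : ∀ i, 0 < a i) (hb : ∀ i, 0 < b i)
    (hw : ∀ i, 0 < w i) (hw1 : ∑ i, w i = 1)
    {Ω : Type*} [MeasurableSpace Ω] (μ : Measure Ω) [IsProbabilityMeasure μ]
    (ι : ℕ → Ω → Fin m) (hmeas : ∀ n, Measurable (ι n))
    (hindep : iIndepFun ι μ)
    (hlaw : ∀ n i, μ (ι n ⁻¹' {i}) = ENNReal.ofReal (w i))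
    (A : Fin m × Fin m → Matrix (Fin 2) (Fin 2) ℝ)
    (hA : ∀ i j, A (i, j) =
      ThreeTerm.stepMatrix (a i) (b i) * ThreeTerm.stepMatrix (a j) (b j))
    (W : Fin m × Fin m → ℝ) (hW : ∀ i j, W (i, j) = w i * w j) :
    (∀ i j p q, 0 < A (i, j) p q) ∧
    ∃ T : ThreeTerm.V →ₗ[ℂ] ThreeTerm.V,
      ThreeTerm.IsOperatorOf (ThreeTerm.bCoeff A W) T ∧
      ∃ hv : ThreeTerm.vVec A W ∈ ThreeTerm.V,
      ∃ S : ℝ,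
        Tendsto (fun N : ℕ => ∑ k ∈ Finset.range N,
            (((T ^ k) ⟨ThreeTerm.vVec A W, hv⟩ : ThreeTerm.V) : ℕ → ℂ) 0)
          atTop (𝓝 (S : ℂ)) ∧
        ∀ᵐ ω ∂μ, Tendsto
          (fun n : ℕ => ThreeTerm.recSeq a b (fun k => ι k ω) n ^ (1 / (n : ℝ)))
          atTop (𝓝 (Real.exp (1 / 2 * S))) := by
  have hpos := stepMatrix_mul_pos hA ha hb
  have hposA : ∀ x p q, 0 < A x p q := fun x => hpos x.1 x.2
  have hdet := det_stepMatrix_mul_ne_zero hA hb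
  have hW0 : ∀ x, 0 ≤ W x := fun x => by
    rw [show x = (x.1, x.2) from rfl, hW]
    exact (mul_pos (hw _) (hw _)).le
  have hW1 : ∑ x, W x = 1 := by
    simp only [Fintype.sum_prod_type, hW, ← Finset.mul_sum, hw1, mul_one]
  -- Weights with sum 1 exclude the empty alphabet.
  have : Nonempty (Fin m) := by
    by_contra h
    rw [not_nonempty_iff] at h
    simp at hw1
  obtain ⟨c, M, hc, hcM, hcA, hAM⟩ := exists_entries_bounds hposA
  obtain ⟨T, hT⟩ := exists_operator hposA W
  obtain ⟨S, hS⟩ := exists_tendsto_logAvg_sub hc hcA hAM hW0 hW1 hcM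
  refine ⟨hpos, T, fun u k => (hT u k).tendsto_sum_nat, vVec_mem_V hposA W, S, ?_, ?_⟩
  · rw [← tendsto_add_atTop_iff_nat 1]
    simp only [sum_pow_operator_apply_zero hposA hdet hW1 hT]
    exact (Complex.continuous_ofReal.tendsto S).comp hS
  let φ : List (Fin m × Fin m) → ℝ := fun l => Real.log (entrySum (wordProd A l))
  let ψ : List (Fin m) → ℝ := fun l =>
    Real.log (entrySum (wordProd (fun i => stepMatrix (a i) (b i)) l))
  have hφψ : ∀ l, φ l = ψ (flattenPairs l) := fun l => by
    simp only [φ, ψ, wordProd_eq_flattenPairs hA]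
  -- The strong law is applied to single letters from index 2 on, in blocks of 2L; countably many L
  -- share one null set.
  have hblocks : ∀ᵐ ω ∂μ, ∀ L : ℕ, Tendsto (fun K : ℕ =>
      (∑ j ∈ Finset.range K,
        ψ (seqWord (fun k => ι (2 + (j * (2 * L) + k)) ω) (2 * L))) / K) atTop
      (𝓝 (wordAvg w (2 * L) ψ)) :=
    ae_all_iff.2 fun L => ae_tendsto_block_average (X := fun k => ι (2 + k))
      (fun n => hmeas _) (hindep.precomp (add_right_injective 2))
      (fun n i => by rw [measureReal_def, hlaw, ENNReal.toReal_ofReal (hw i).le]) (2 * L) ψ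
  filter_upwards [hblocks] with ω hω
  set κ : ℕ → Fin m × Fin m := fun t => (ι (2 * t + 3) ω, ι (2 * t + 2) ω) with hκ
  have hlim : Tendsto (fun n : ℕ => φ (seqWord κ n) / n) atTop (𝓝 S) := by
    refine tendsto_apply_seqWord_div (abs_log_entrySum_append_le hc hcA hAM hcM)
      -- Since the alphabet is finite, the sum of all |φ [x]| serves as the bound D.
      (Finset.sum_nonneg fun x _ => abs_nonneg (φ [x]))
      (fun x => Finset.single_le_sum (f := fun x => |φ [x]|) (fun x _ => abs_nonneg _)
        (Finset.mem_univ x)) (tendsto_div_of_tendsto_sub hS) κ fun L _ => ?_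
    have hmean : logAvg A W L = wordAvg w (2 * L) ψ := by
      rw [← wordAvg_flattenPairs hW]
      exact congrArg (wordAvg W L) (funext hφψ)
    rw [hmean]
    refine (hω L).congr fun K => ?_
    congr 1
    refine Finset.sum_congr rfl fun j _ => ?_
    refine Eq.trans ?_ (hφψ _).symm
    rw [← flattenPairs_seqWord]
    congr 3
    funext k
    have e3 : 2 * (j * L + k) + 3 = 2 + (j * (2 * L) + (2 * k + 1)) := by ring
    have e2 : 2 * (j * L + k) + 2 = 2 + (j * (2 * L) + 2 * k) := by ring
    simp only [hκ, e3, e2]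
  refine tendsto_rpow_of_abs_log_sub_le (C := -Real.log (c / (2 * M)))
    (recSeq_pos ha hb fun k => ι k ω) hlim fun n => ?_
  set B := wordProd A (seqWord κ (n / 2)) with hB
  have hBa : IsAllowable B := isAllowable_wordProd hposA _
  -- The parity of n selects the row.
  have hrow : ∃ p, recSeq a b (fun k => ι k ω) n = B p 0 + B p 1 := by
    have h := rowSum_wordProd_seqWord hA (fun k => ι k ω) (n / 2)
    rcases Nat.mod_two_eq_zero_or_one n with h2 | h2
    · exact ⟨0, by rw [← Nat.div_add_mod n 2, h2]; exact h.1.symm⟩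
    · exact ⟨1, by rw [← Nat.div_add_mod n 2, h2]; exact h.2.symm⟩
  obtain ⟨p, hp⟩ := hrow
  have hM0 : 0 < M := hc.trans_le hcM
  have hs := hBa.entrySum_pos
  have hlow := mul_entrySum_wordProd_le hc hcA hAM (seqWord κ (n / 2)) hcM p
  have hup : B p 0 + B p 1 ≤ entrySum B := by
    have h0 := hBa.2 0
    have h1 := hBa.2 1
    unfold entrySum
    fin_cases p <;> simp <;> linarith
  have hlow := Real.log_le_log (by positivity) hlow
  rw [Real.log_mul (by positivity) hs.ne'] at hlow
  have hup := Real.log_le_log (hBa.2 p) hup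
  have hκ1 : Real.log (c / (2 * M)) ≤ 0 :=
    Real.log_nonpos (by positivity) ((div_le_one (by positivity)).2 (by linarith))
  rw [hp, abs_le]
  constructor
  · linarith
  · linarith
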